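/- Let $c>0$, $k>0$ and put $U_0(\xi)=3c\,\mathrm{sech}^2\!\big(\tfrac{\sqrt c}{2}\xi\big)$, $g(\xi)=\mathrm{sech}^p\!\big(\tfrac{\sqrt c}{2}\xi\big)$ with $p=\tfrac12(\sqrt{1+48k}-1)$, $\Omega_c=-\tfrac{c}{16}(\sqrt{1+48k}-1)^2$, and $L_1=-\partial_\xi^2+c-U_0$, regarded as an operator from $H^2_{\rm even}(\mathbb R)$ to the even functions in $L^2(\mathbb R)$. Consider real solutions $(U,A)\in H^2_{\rm even}(\mathbb R)\times H^2_{\rm even}(\mathbb R)$ of the system (with $s=\mathrm{sgn}(k)=1$) $$U''-cU+\tfrac12U^2+A^2=0,\qquad A''+(\Omega+kU)A=0. \qquad(*)$$ Write $\langle\cdot,\cdot\rangle$ for the inner product of $L^2(\mathbb R)$, and assume that $q:=\langle g^2,L_1^{-1}g^2\rangle\neq0$. Then there are constants $C,\varepsilon,r>0$ depending only on $c$ and $k$, and a family $\Omega\mapsto(U_\Omega,A_\Omega)$, such that for every $\Omega$ with $|\Omega-\Omega_c|<\varepsilon$ and $\mathrm{sgn}(\Omega-\Omega_c)=-\mathrm{sgn}(q)$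 the following hold. 1. $(U_\Omega,A_\Omega)\in H^2_{\rm even}(\mathbb R)\times H^2_{\rm even}(\mathbb R)$ solves $(*)$, the number $a:=\langle g,A_\Omega\rangle/\|g\|_{L^2}^2$ is positive (so that $A_\Omega\ne0$), and $$\|U_\Omega-U_0\|_{H^2}\le C|\Omega-\Omega_c|,\qquad \|A_\Omega\|_{H^2}\le C\sqrt{|\Omega-\Omega_c|}.$$ 2. The amplitude $a$ satisfies $\Omega-\Omega_c=-k\,a^2\,\dfrac{\langle g^2,L_1^{-1}g^2\rangle}{\|g\|_{L^2}^2}+\mathcal O(a^4)$, with the error term bounded by $Ca^4$. 3. The family is unique up to the symmetry $A\mapsto-A$: if $(V,B)\in H^2_{\rm even}(\mathbb R)\times H^2_{\rm even}(\mathbb R)$ solves $(*)$ for this $\Omega$, $B\neq0$, $\|V-U_0\|_{H^2}<r$ and $\|B\|_{L^2}<r$, then $V=U_\Omega$ and $B=A_\Omega$ or $B=-A_\Omega$. -/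

import Mathlib

open MeasureTheory Filter
open scoped ContDiff

namespace KdVLS

noncomputable section

/-- `g` is the weak (distributional) derivative of `f` on the real line. -/
def HasWeakDeriv (f g : ℝ → ℝ) : Prop :=
  LocallyIntegrable f ∧ LocallyIntegrable g ∧
    ∀ φ : ℝ → ℝ, ContDiff ℝ ∞ φ → HasCompactSupport φ →
      ∫ x, f x * deriv φ x = -∫ x, g x * φ x

open Classical in
/-- A chosen weak derivative of `f`, unique up to null sets (and `0` if there is none). -/
def weakDeriv (f : ℝ → ℝ) : ℝ → ℝ :=
  if h : ∃ g, HasWeakDeriv f g then Classical.choose h else 0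

/-- `f` (a representative of a class of functions) belongs to the Sobolev space `H²(ℝ)`. -/
def MemH2 (f : ℝ → ℝ) : Prop :=
  ∃ f₁ f₂ : ℝ → ℝ, HasWeakDeriv f f₁ ∧ HasWeakDeriv f₁ f₂ ∧
    MemLp f 2 volume ∧ MemLp f₁ 2 volume ∧ MemLp f₂ 2 volume

/-- `f` belongs to `H²_even(ℝ)`: it is in `H²(ℝ)` and even as a class of functions. -/
def MemH2Even (f : ℝ → ℝ) : Prop :=
  MemH2 f ∧ ∀ᵐ x, f (-x) = f x

/-- The second weak derivative. -/
def weakDeriv₂ (f : ℝ → ℝ) : ℝ → ℝ := weakDeriv (weakDeriv f)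

/-- The inner product of `L²(ℝ)`. -/
def innerL2 (f h : ℝ → ℝ) : ℝ := ∫ x, f x * h x

/-- The norm of `L²(ℝ)`. -/
def normL2 (f : ℝ → ℝ) : ℝ := Real.sqrt (innerL2 f f)

/-- The norm of `H²(ℝ)`. -/
def normH2 (f : ℝ → ℝ) : ℝ :=
  Real.sqrt (normL2 f ^ 2 + normL2 (weakDeriv f) ^ 2 + normL2 (weakDeriv₂ f) ^ 2)

/-- The system `U'' - c U + U²/2 + s A² = 0`, `A'' + (Ω + k U) A = 0` for profiles in
`H²(ℝ)`, with equality in `L²(ℝ)`. -/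
def IsProfile (c k s Ω : ℝ) (U A : ℝ → ℝ) : Prop :=
  (∀ᵐ ξ, weakDeriv₂ U ξ - c * U ξ + 1 / 2 * U ξ ^ 2 + s * A ξ ^ 2 = 0) ∧
  (∀ᵐ ξ, weakDeriv₂ A ξ + (Ω + k * U ξ) * A ξ = 0)

/-- The KdV soliton `3 c sech² (√c ξ / 2)`. -/
def soliton (c : ℝ) (ξ : ℝ) : ℝ := 3 * c * (1 / Real.cosh (Real.sqrt c / 2 * ξ)) ^ 2

/-- The exponent `p = (√(1 + 48 k) - 1) / 2`. -/
def expo (k : ℝ) : ℝ := (Real.sqrt (1 + 48 * k) - 1) / 2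

/-- The eigenfunction `g = sech^p (√c ξ / 2)`. -/
def eigenfun (c k : ℝ) (ξ : ℝ) : ℝ := (1 / Real.cosh (Real.sqrt c / 2 * ξ)) ^ expo k

/-- The bifurcation point `Ω_c`. -/
def Omegac (c k : ℝ) : ℝ := -(c / 16) * (Real.sqrt (1 + 48 * k) - 1) ^ 2

/-- The Schrödinger operator `L₁ = -∂² + c - U₀` at the soliton `U₀`. -/
def opL₁ (c : ℝ) (W : ℝ → ℝ) (ξ : ℝ) : ℝ :=
  -weakDeriv₂ W ξ + (c - soliton c ξ) * W ξ

open Classical in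
/-- `L₁⁻¹ f`, for the operator `L₁` acting from `H²_even(ℝ)` to even functions of `L²(ℝ)`, where it
is injective; the value is a representative, and it is `0` if `f` is not in the range. -/
def invL₁ (c : ℝ) (f : ℝ → ℝ) : ℝ → ℝ :=
  if h : ∃ W, MemH2Even W ∧ opL₁ c W =ᵐ[volume] f then Classical.choose h else 0

/-- The number `⟨g², L₁⁻¹ g²⟩`. -/
def bifCoeff (c k : ℝ) : ℝ :=
  innerL2 (fun ξ => eigenfun c k ξ ^ 2) (invL₁ c (fun ξ => eigenfun c k ξ ^ 2))

/-- The amplitude `a = ⟨g, A⟩ / ‖g‖²`, that is, `A = a g + z₁` with `⟨g, z₁⟩ = 0`. -/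
def amplitude (c k : ℝ) (A : ℝ → ℝ) : ℝ :=
  innerL2 (eigenfun c k) A / normL2 (eigenfun c k) ^ 2

end

end KdVLS

/-!
The proof is a Lyapunov–Schmidt reduction in which the degenerate direction is blown up, so that
both existence and uniqueness come from one application of the implicit function theorem.

*Reduction.* On the Hilbert space `Y` of even `L²` functions let `S` be the inverse of `L₁` and `R`
the inverse of `L₂ + P`, where `L₂ = -∂² - Ω_c - k U₀` has kernel spanned by the eigenfunction `g`
and `P` is the orthogonal projection on `g`. With `U = U₀ + S F`, `A = R θ` and `δ = Ω - Ω_c` the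
coupled system reads `F = (S F)² / 2 + (R θ)²`, `θ = P θ + (δ + k S F) R θ`; this is
`BifurcationData.IsSol`, and `Realizes.isProfile` and `Realizes.exists_isSol` translate between the
two forms. Since `S` and `R` map `L²` into `H² ⊆ L^∞`, the products are bounded bilinear maps on `Y`.

*Blow-up.* Put `θ = a η`, `F = α f` with `α = a²` and `⟨g, η⟩ = ‖g‖²`. At `δ = 0` the resulting
system has the solution `α = 0`, `f = g²`, `η = g`, and its linearisation in `(α, f, η)` is
triangular with diagonal entry `k q`, where `q = ⟨g², L₁⁻¹ g²⟩`. As `q ≠ 0`, the solutions near that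
point form a curve over `δ` (`exists_curve`), along which
`δ ‖g‖² + α k q = O(α²)`; so `α > 0` exactly when `δ` and `q` have opposite signs. Conversely a small
solution with `θ ≠ 0` has a blow-up near the base point (`blowUp_near_base`), so it lies on the
curve, and only the sign of `a` is left free.

*Linear theory.* Both operators are inverted by first-order factorisations. With
`D_p = ∂ + p b tanh (b x)`, `b = √c / 2`, one has `L₂ = D_p* D_p` for the exponent `p` of `g`, and
`L₁ D₃* = D₃* D₂* D₂`, `L₁ sech³ (b x) = -5 b² sech³ (b x)`. The operators `D_p` and `D_p*` are
inverted by explicit integrals whose kernels are dominated by `e^{-p b |x - t|}`, hence bounded on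
`L²` by the Schur test (`memLp_of_exp_kernel`). Since the operators are symmetric on `H²`,
solvability for all right-hand sides gives uniqueness, and boundedness of the inverses follows from
the Hellinger–Toeplitz theorem (`exists_clm_of_symmetric_relation`).
-/

namespace KdVLS

/-! ### The abstract bifurcation theorem -/

section Abstract

open Topology

/-- The data of the Lyapunov–Schmidt reduction, on a Banach space `Y`. For the coupled system,
`Y` is the space of even `L²` functions, `g` spans the kernel of the second operator `L₂`, `ℓ` is
the pairing with `g`, `R` inverts `L₂` plus the projection on `g`, and `b₁₁`, `b₁₂`, `b₂₂` are the
products `S f · S f'`, `S f · R η`, `R η · R η'`, where `S` inverts `L₁`. -/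
structure BifurcationData (Y : Type*) [NormedAddCommGroup Y] [NormedSpace ℝ Y] where
  g : Y
  ℓ : Y →L[ℝ] ℝ
  R : Y →L[ℝ] Y
  b₁₁ : Y →L[ℝ] Y →L[ℝ] Y
  b₁₂ : Y →L[ℝ] Y →L[ℝ] Y
  b₂₂ : Y →L[ℝ] Y →L[ℝ] Y
  k : ℝ
  k_pos : 0 < k
  ℓ_g_pos : 0 < ℓ g
  ℓ_R : ∀ η, ℓ (R η) = ℓ η

namespace BifurcationData

variable {Y : Type*} [NormedAddCommGroup Y] [NormedSpace ℝ Y] (D : BifurcationData Y)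

/-- The bifurcation coefficient: `⟨g², L₁⁻¹ g²⟩` for the coupled system. -/
noncomputable def q : ℝ := D.ℓ (D.b₁₂ (D.b₂₂ D.g D.g) D.g)

/-- The system for `F = L₁ w` and `θ = L₂ A + P A`, where `P` is the projection on `g`. -/
def IsSol (δ : ℝ) (F θ : Y) : Prop :=
  F = (1 / 2 : ℝ) • D.b₁₁ F F + D.b₂₂ θ θ ∧
    θ = (D.ℓ θ / D.ℓ D.g) • D.g + δ • D.R θ + D.k • D.b₁₂ F θ

/-- The system after the blow-up `θ = a η`, `F = α f`, `α = a²`, as a map whose zeros are the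
solutions; the unknowns are `δ` and `(α, f, η)`. -/
noncomputable def blowUp (v : ℝ × (ℝ × Y × Y)) : ℝ × Y × Y :=
  (D.ℓ v.2.2.2 - D.ℓ D.g,
    v.2.2.1 - (v.2.1 / 2) • D.b₁₁ v.2.2.1 v.2.2.1 - D.b₂₂ v.2.2.2 v.2.2.2,
    v.2.2.2 - D.g - v.1 • D.R v.2.2.2 - (D.k * v.2.1) • D.b₁₂ v.2.2.1 v.2.2.2)

/-- The point `δ = 0`, `α = 0`, `f = b₂₂ g g`, `η = g` at which the branch starts. -/
noncomputable def base : ℝ × Y × Y := (0, D.b₂₂ D.g D.g, D.g)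

theorem blowUp_base : D.blowUp (0, D.base) = 0 := by
  simp [blowUp, base]

theorem contDiff_blowUp : ContDiff ℝ 1 D.blowUp := by
  unfold blowUp
  fun_prop

/-- The partial derivative of the blown-up system in `(α, f, η)` at the base point. -/
noncomputable def partialDeriv : (ℝ × Y × Y) →L[ℝ] (ℝ × Y × Y) :=
  fderiv ℝ D.blowUp (0, D.base) ∘L .inr ℝ ℝ (ℝ × Y × Y)

theorem partialDeriv_apply (v : ℝ × Y × Y) : D.partialDeriv v =
    (D.ℓ v.2.2,
      v.2.1 - (v.1 / 2) • D.b₁₁ (D.b₂₂ D.g D.g) (D.b₂₂ D.g D.g)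
        - (D.b₂₂ D.g v.2.2 + D.b₂₂ v.2.2 D.g),
      v.2.2 - (D.k * v.1) • D.b₁₂ (D.b₂₂ D.g D.g) D.g) := by
  have h1 : HasFDerivAt D.blowUp (fderiv ℝ D.blowUp (0, D.base)) (0, D.base) :=
    (D.contDiff_blowUp.differentiable (by norm_num) _).hasFDerivAt
  have h1' : HasFDerivAt D.blowUp (fderiv ℝ D.blowUp (0, D.base))
      ((0, D.base) + (0 : ℝ) • ((0 : ℝ), v)) := by simpa using h1
  have h2 : HasDerivAt (fun t : ℝ => (0, D.base) + t • ((0 : ℝ), v)) ((0 : ℝ), v) 0 := by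
    simpa using ((hasDerivAt_id (0 : ℝ)).smul_const ((0 : ℝ), v)).const_add (0, D.base)
  have h3 := h1'.comp_hasDerivAt (0 : ℝ) h2
  obtain ⟨α, f, η⟩ := v
  have hid : HasDerivAt (fun t : ℝ => t) 1 0 := hasDerivAt_id _
  have hf : HasDerivAt (fun t : ℝ => D.b₂₂ D.g D.g + t • f) f 0 := by
    simpa using (hid.smul_const f).const_add (D.b₂₂ D.g D.g)
  have hη : HasDerivAt (fun t : ℝ => D.g + t • η) η 0 := by
    simpa using (hid.smul_const η).const_add D.g
  have hα : HasDerivAt (fun t : ℝ => t * α) α 0 := by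
    simpa using hid.mul_const α
  have hb {b : Y →L[ℝ] Y →L[ℝ] Y} {x y : ℝ → Y} {x' y' : Y} (hx : HasDerivAt x x' 0)
      (hy : HasDerivAt y y' 0) : HasDerivAt (fun t => b (x t) (y t)) (b x' (y 0) + b (x 0) y') 0 :=
    (b.hasFDerivAt.comp_hasDerivAt (0 : ℝ) hx).clm_apply hy
  have h4 := ((D.ℓ.hasFDerivAt.comp_hasDerivAt (0 : ℝ) hη).sub_const (D.ℓ D.g)).prodMk
    (((hf.sub ((hα.div_const 2).smul (hb (b := D.b₁₁) hf hf))).sub (hb (b := D.b₂₂) hη hη)).prodMk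
      ((hη.sub_const D.g).sub ((hα.const_mul D.k).smul (hb (b := D.b₁₂) hf hη))))
  have h5 := h3.unique (h4.congr_of_eventuallyEq (Eventually.of_forall fun t => by
    simp [blowUp, base]))
  simp only [partialDeriv, ContinuousLinearMap.comp_apply, ContinuousLinearMap.inr_apply]
  rw [h5]
  simp
  abel

/-- The partial derivative is triangular with the diagonal entry `k q` for `α`. -/
theorem partialDeriv_isInvertible (hq : D.q ≠ 0) : D.partialDeriv.IsInvertible := by
  have hk := D.k_pos.ne'
  let n := D.b₁₂ (D.b₂₂ D.g D.g) D.g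
  let A : (ℝ × Y × Y) →L[ℝ] ℝ := (D.k * D.q)⁻¹ •
    (.fst ℝ ℝ (Y × Y) - D.ℓ ∘L .snd ℝ Y Y ∘L .snd ℝ ℝ (Y × Y))
  let N : (ℝ × Y × Y) →L[ℝ] Y := .snd ℝ Y Y ∘L .snd ℝ ℝ (Y × Y) + D.k • A.smulRight n
  let X : (ℝ × Y × Y) →L[ℝ] Y := .fst ℝ Y Y ∘L .snd ℝ ℝ (Y × Y)
    + (1 / 2 : ℝ) • A.smulRight (D.b₁₁ (D.b₂₂ D.g D.g) (D.b₂₂ D.g D.g))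
    + (D.b₂₂ D.g + D.b₂₂.flip D.g) ∘L N
  have hn : D.ℓ n = D.q := rfl
  have hA : ∀ v, A v = (D.k * D.q)⁻¹ * (v.1 - D.ℓ v.2.2) := fun v => by simp [A]
  have hN : ∀ v, N v = v.2.2 + (D.k * A v) • n := fun v => by simp [N, mul_smul]
  have hX : ∀ v, X v = v.2.1 + (A v / 2) • D.b₁₁ (D.b₂₂ D.g D.g) (D.b₂₂ D.g D.g)
      + (D.b₂₂ D.g (N v) + D.b₂₂ (N v) D.g) := fun v => by
    simp [X, smul_smul, div_eq_inv_mul]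
  refine ⟨ContinuousLinearEquiv.equivOfInverse D.partialDeriv (A.prod (X.prod N)) ?_ ?_, ?_⟩
  · intro v
    have h1 : A (D.partialDeriv v) = v.1 := by
      rw [hA, D.partialDeriv_apply]
      simp only [map_sub, map_smul, smul_eq_mul]
      rw [show D.ℓ (D.b₁₂ (D.b₂₂ D.g D.g) D.g) = D.q from rfl]
      field_simp
      ring
    have h2 : N (D.partialDeriv v) = v.2.2 := by
      rw [hN, h1, D.partialDeriv_apply]
      simp [n]
    have h3 : X (D.partialDeriv v) = v.2.1 := by
      rw [hX, h1, h2, D.partialDeriv_apply]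
      simp only
      abel
    simp only [ContinuousLinearMap.prod_apply, h1, h2, h3]
  · intro v
    rw [D.partialDeriv_apply]
    simp only [ContinuousLinearMap.prod_apply]
    have h1 : D.ℓ (N v) = v.1 := by
      rw [hN, map_add, map_smul, hn, hA, smul_eq_mul]
      field_simp
      ring
    refine Prod.ext h1 (Prod.ext ?_ ?_)
    · simp only [hX v]
      abel
    · simp only [hN v]
      simp [n]
  · rfl

/-- Near the base point the zeros of the blown-up system form a curve parametrised by `δ`. -/
theorem exists_curve [CompleteSpace Y] (hq : D.q ≠ 0) : ∃ ψ : ℝ → ℝ × Y × Y,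
    ψ 0 = D.base ∧ DifferentiableAt ℝ ψ 0 ∧ (∀ᶠ δ in 𝓝 0, D.blowUp (δ, ψ δ) = 0) ∧
      ∀ᶠ v in 𝓝 ((0 : ℝ), D.base), D.blowUp v = 0 → v.2 = ψ v.1 := by
  have hs : HasStrictFDerivAt D.blowUp (fderiv ℝ D.blowUp (0, D.base)) (0, D.base) :=
    D.contDiff_blowUp.contDiffAt.hasStrictFDerivAt (by norm_num)
  have hi := D.partialDeriv_isInvertible hq
  have he := hs.eventually_apply_eq_iff_implicitFunctionOfProdDomain hi
  rw [D.blowUp_base] at he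
  refine ⟨hs.implicitFunctionOfProdDomain hi, (he.self_of_nhds.1 D.blowUp_base),
    (hs.hasStrictFDerivAt_implicitFunctionOfProdDomain hi).hasFDerivAt.differentiableAt, ?_, ?_⟩
  · have := hs.eventually_apply_implicitFunctionOfProdDomain hi
    rwa [D.blowUp_base] at this
  · filter_upwards [he] with v hv h
    exact (hv.1 h).symm

/-- Undoing the blow-up: a zero with `α = a²` gives the solution `(α f, a η)`. -/
theorem isSol_of_blowUp {δ a : ℝ} {f η : Y} (h : D.blowUp (δ, a ^ 2, f, η) = 0) :
    D.IsSol δ (a ^ 2 • f) (a • η) ∧ D.ℓ (a • η) = a * D.ℓ D.g := by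
  simp only [blowUp, Prod.mk_eq_zero, sub_eq_zero] at h
  obtain ⟨h1, h2, h3⟩ := h
  have h2' : f = (a ^ 2 / 2) • D.b₁₁ f f + D.b₂₂ η η := by
    rw [← h2]; abel
  have h3' : η = D.g + δ • D.R η + (D.k * a ^ 2) • D.b₁₂ f η := by
    rw [← h3]; abel
  have hl : D.ℓ (a • η) = a * D.ℓ D.g := by rw [map_smul, h1, smul_eq_mul]
  refine ⟨⟨?_, ?_⟩, hl⟩
  · conv_lhs => rw [h2']
    simp only [map_smul, smul_add, smul_apply, smul_smul]
    ring_nf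
  · rw [hl, mul_div_cancel_right₀ _ D.ℓ_g_pos.ne']
    conv_lhs => rw [h3']
    simp only [map_smul, smul_add, smul_apply, smul_smul]
    ring_nf

/-- The blow-up of a solution with nonzero amplitude. -/
theorem blowUp_of_isSol {δ a : ℝ} {F θ : Y} (h : D.IsSol δ F θ) (hl : D.ℓ θ = a * D.ℓ D.g)
    (ha : a ≠ 0) : D.blowUp (δ, a ^ 2, (a ^ 2)⁻¹ • F, a⁻¹ • θ) = 0 := by
  obtain ⟨h2, h3⟩ := h
  rw [hl, mul_div_cancel_right₀ _ D.ℓ_g_pos.ne'] at h3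
  simp only [blowUp, Prod.mk_eq_zero, sub_eq_zero]
  refine ⟨?_, ?_, ?_⟩
  · rw [map_smul, hl, smul_eq_mul]
    field_simp
  · conv_lhs => enter [1]; rw [h2]
    simp only [map_smul, smul_add, smul_apply, smul_smul]
    rw [show (a ^ 2 / 2 * ((a ^ 2)⁻¹ * (a ^ 2)⁻¹)) = (a ^ 2)⁻¹ * (1 / 2) by field_simp,
      show a⁻¹ * a⁻¹ = (a ^ 2)⁻¹ by field_simp]
    abel
  · conv_lhs => enter [1, 1]; rw [h3]
    simp only [map_smul, smul_add, smul_apply, smul_smul]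
    rw [inv_mul_cancel₀ ha, one_smul,
      show D.k * a ^ 2 * (a⁻¹ * (a ^ 2)⁻¹) = a⁻¹ * D.k by field_simp, mul_comm a⁻¹ δ]
    abel

/-- A priori bounds: a small solution with `θ ≠ 0` has nonzero amplitude, and its blow-up is near
the base point. -/
theorem blowUp_near_base {ρ : ℝ} (hρ : 0 < ρ) : ∃ r > 0, ∀ (δ a : ℝ) (F θ : Y),
    D.IsSol δ F θ → θ ≠ 0 → D.ℓ θ = a * D.ℓ D.g → |δ| < r → |a| < r → ‖F‖ < r →
    a ≠ 0 ∧ a ^ 2 < ρ ∧ ‖(a ^ 2)⁻¹ • F - D.b₂₂ D.g D.g‖ < ρ ∧ ‖a⁻¹ • θ - D.g‖ < ρ := by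
  set c₁ := ‖D.R‖ + D.k * ‖D.b₁₂‖ with hc₁
  have hc₁0 : 0 ≤ c₁ := by have := D.k_pos; positivity
  set n := ‖D.g‖ with hn
  set K := 8 * ‖D.b₂₂‖ * n ^ 2 with hK
  have hK0 : 0 ≤ K := by positivity
  set M := 1 + 2 * c₁ * n + ‖D.b₁₁‖ * K + 6 * ‖D.b₂₂‖ * c₁ * n ^ 2 with hM
  have hM1 : 1 ≤ M := by
    have : 0 ≤ 2 * c₁ * n + ‖D.b₁₁‖ * K + 6 * ‖D.b₂₂‖ * c₁ * n ^ 2 := by positivity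
    linarith
  have hM0 : 0 < M := by linarith
  -- `r` is small enough for both equations to be contractive, and for `M r ≤ ρ`
  refine ⟨min (min 1 (ρ / M)) (min (1 / (2 * (c₁ + 1))) (1 / (‖D.b₁₁‖ + 1))), by positivity, ?_⟩
  intro δ a F θ hsol hθ hl hδ haa hF
  set r := min (min 1 (ρ / M)) (min (1 / (2 * (c₁ + 1))) (1 / (‖D.b₁₁‖ + 1))) with hr
  have hr0 : 0 < r := by positivity
  have hr1 : r ≤ 1 := (min_le_left _ _).trans (min_le_left _ _)
  have hr2 : M * r ≤ ρ := by
    have : r ≤ ρ / M := (min_le_left _ _).trans (min_le_right _ _)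
    rw [le_div_iff₀ hM0] at this
    linarith
  have hr3 : c₁ * r ≤ 1 / 2 := by
    have : r ≤ 1 / (2 * (c₁ + 1)) := (min_le_right _ _).trans (min_le_left _ _)
    rw [le_div_iff₀ (by positivity)] at this
    nlinarith
  have hr4 : ‖D.b₁₁‖ * r ≤ 1 := by
    have : r ≤ 1 / (‖D.b₁₁‖ + 1) := (min_le_right _ _).trans (min_le_right _ _)
    rw [le_div_iff₀ (by positivity)] at this
    nlinarith
  clear_value r
  have hθg : ‖θ - a • D.g‖ ≤ c₁ * r * ‖θ‖ := by
    have h := hsol.2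
    rw [hl, mul_div_cancel_right₀ _ D.ℓ_g_pos.ne'] at h
    have h' : θ - a • D.g = δ • D.R θ + D.k • D.b₁₂ F θ := by
      conv_lhs => rw [h]
      abel
    rw [h']
    calc ‖δ • D.R θ + D.k • D.b₁₂ F θ‖ ≤ |δ| * (‖D.R‖ * ‖θ‖) + D.k * (‖D.b₁₂‖ * ‖F‖ * ‖θ‖) := by
          refine (norm_add_le _ _).trans (add_le_add ?_ ?_)
          · rw [norm_smul, Real.norm_eq_abs]
            gcongr
            exact D.R.le_opNorm θ
          · rw [norm_smul, Real.norm_of_nonneg D.k_pos.le]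
            have := D.k_pos
            gcongr
            exact D.b₁₂.le_opNorm₂ F θ
      _ ≤ r * (‖D.R‖ * ‖θ‖) + D.k * (‖D.b₁₂‖ * r * ‖θ‖) := by
          have := D.k_pos
          gcongr
      _ = c₁ * r * ‖θ‖ := by rw [hc₁]; ring
  have hθ0 : 0 < ‖θ‖ := norm_pos_iff.2 hθ
  have ha : a ≠ 0 := by
    rintro rfl
    rw [zero_smul, sub_zero] at hθg
    have h4 : c₁ * r * ‖θ‖ ≤ 1 / 2 * ‖θ‖ := by gcongr
    linarith
  have ha2 : 0 < a ^ 2 := by positivity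
  obtain ⟨h1, h2, h3⟩ : _ ∧ _ ∧ _ := by
    simpa only [blowUp, Prod.mk_eq_zero, sub_eq_zero] using D.blowUp_of_isSol hsol hl ha
  set f := (a ^ 2)⁻¹ • F with hf
  set η := a⁻¹ • θ with hη
  have hηg : ‖η - D.g‖ ≤ c₁ * r * ‖η‖ := by
    have : η - D.g = a⁻¹ • (θ - a • D.g) := by
      rw [smul_sub, smul_smul, inv_mul_cancel₀ ha, one_smul]
    rw [this, hη, norm_smul, norm_smul]
    calc ‖a⁻¹‖ * ‖θ - a • D.g‖ ≤ ‖a⁻¹‖ * (c₁ * r * ‖θ‖) := by gcongr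
      _ = _ := by ring
  have hηn : ‖η‖ ≤ 2 * n := by
    have := norm_le_norm_add_norm_sub' η D.g
    have h4 : c₁ * r * ‖η‖ ≤ 1 / 2 * ‖η‖ := by gcongr
    linarith
  have hηg' : ‖η - D.g‖ ≤ 2 * c₁ * n * r := by
    calc _ ≤ c₁ * r * ‖η‖ := hηg
      _ ≤ c₁ * r * (2 * n) := by gcongr
      _ = _ := by ring
  -- the quadratic term of the first equation, in which `α f = F` is small
  have hquad : ‖(a ^ 2 / 2) • D.b₁₁ f f‖ ≤ ‖D.b₁₁‖ * r / 2 * ‖f‖ := by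
    have h' : (a ^ 2 / 2) • D.b₁₁ f f = (1 / 2 : ℝ) • D.b₁₁ F f := by
      conv_rhs => rw [show F = a ^ 2 • f by rw [hf, smul_smul, mul_inv_cancel₀ ha2.ne', one_smul]]
      simp only [map_smul, smul_apply, smul_smul]
      ring_nf
    rw [h', norm_smul, Real.norm_of_nonneg (by norm_num)]
    calc 1 / 2 * ‖D.b₁₁ F f‖ ≤ 1 / 2 * (‖D.b₁₁‖ * ‖F‖ * ‖f‖) := by
          gcongr; exact D.b₁₁.le_opNorm₂ F f
      _ ≤ 1 / 2 * (‖D.b₁₁‖ * r * ‖f‖) := by gcongr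
      _ = _ := by ring
  have h2' : f = (a ^ 2 / 2) • D.b₁₁ f f + D.b₂₂ η η := by rw [← h2]; abel
  have hfK : ‖f‖ ≤ K := by
    have hb : ‖D.b₂₂ η η‖ ≤ ‖D.b₂₂‖ * (2 * n) * (2 * n) :=
      (D.b₂₂.le_opNorm₂ η η).trans (by gcongr)
    have h4 : ‖f‖ ≤ ‖D.b₁₁‖ * r / 2 * ‖f‖ + ‖D.b₂₂‖ * (2 * n) * (2 * n) := by
      conv_lhs => rw [h2']
      exact (norm_add_le _ _).trans (add_le_add hquad hb)
    have h5 : ‖D.b₁₁‖ * r / 2 * ‖f‖ ≤ 1 / 2 * ‖f‖ := by gcongr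
    rw [hK]
    linarith
  have hff : ‖f - D.b₂₂ D.g D.g‖ ≤ ‖D.b₁₁‖ * r / 2 * K + 6 * ‖D.b₂₂‖ * c₁ * n ^ 2 * r := by
    have h4 : f - D.b₂₂ D.g D.g =
        (a ^ 2 / 2) • D.b₁₁ f f + (D.b₂₂ (η - D.g) η + D.b₂₂ D.g (η - D.g)) := by
      conv_lhs => rw [h2']
      simp only [map_sub, sub_apply]
      abel
    rw [h4]
    refine (norm_add_le _ _).trans (add_le_add (hquad.trans (by gcongr)) ?_)
    calc _ ≤ ‖D.b₂₂‖ * (2 * c₁ * n * r) * (2 * n) + ‖D.b₂₂‖ * n * (2 * c₁ * n * r) := by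
          refine (norm_add_le _ _).trans (add_le_add ?_ ?_)
          · exact (D.b₂₂.le_opNorm₂ _ _).trans (by gcongr)
          · exact (D.b₂₂.le_opNorm₂ _ _).trans (by gcongr)
      _ = _ := by ring
  have hp1 : 0 ≤ c₁ * n * r := by positivity
  have hp2 : 0 ≤ ‖D.b₁₁‖ * K * r := by positivity
  have hp3 : 0 ≤ ‖D.b₂₂‖ * c₁ * n ^ 2 * r := by positivity
  have hMr : M * r = r + 2 * (c₁ * n * r) + ‖D.b₁₁‖ * K * r
      + 6 * (‖D.b₂₂‖ * c₁ * n ^ 2 * r) := by rw [hM]; ring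
  refine ⟨ha, ?_, ?_, ?_⟩
  · have h4 : a ^ 2 < r ^ 2 := sq_lt_sq' (by linarith [(abs_lt.1 haa).1]) (abs_lt.1 haa).2
    have h5 : r ^ 2 ≤ r := by
      calc r ^ 2 = r * r := sq r
        _ ≤ 1 * r := by gcongr
        _ = r := one_mul r
    linarith
  · refine hff.trans_lt ?_
    rw [show ‖D.b₁₁‖ * r / 2 * K = ‖D.b₁₁‖ * K * r / 2 by ring,
      show 6 * ‖D.b₂₂‖ * c₁ * n ^ 2 * r = 6 * (‖D.b₂₂‖ * c₁ * n ^ 2 * r) by ring]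
    linarith
  · refine hηg'.trans_lt ?_
    rw [show 2 * c₁ * n * r = 2 * (c₁ * n * r) by ring]
    linarith

/-- The bifurcating branch in abstract form: it exists on the side of `δ = 0` where
`sign δ = -sign q`, and up to the symmetry `θ ↦ -θ` it is the only small solution with `θ ≠ 0`. -/
theorem exists_branch [CompleteSpace Y] (hq : D.q ≠ 0) : ∃ (C ε r : ℝ) (F θ : ℝ → Y), 0 < C ∧ 0 < ε ∧ 0 < r ∧
    ∀ δ : ℝ, |δ| < ε → SignType.sign δ = -SignType.sign D.q →
      (D.IsSol δ (F δ) (θ δ) ∧ 0 < D.ℓ (θ δ) ∧ ‖F δ‖ ≤ C * |δ| ∧ ‖θ δ‖ ≤ C * √|δ| ∧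
        |δ - (-D.k * (D.ℓ (θ δ) / D.ℓ D.g) ^ 2 * (D.q / D.ℓ D.g))|
          ≤ C * (D.ℓ (θ δ) / D.ℓ D.g) ^ 4) ∧
      ∀ F' θ' : Y, D.IsSol δ F' θ' → θ' ≠ 0 → ‖F'‖ < r → |D.ℓ θ' / D.ℓ D.g| < r →
        F' = F δ ∧ (θ' = θ δ ∨ θ' = -θ δ) := by
  obtain ⟨ψ, hψ0, hψd, hψz, hψu⟩ := D.exists_curve hq
  have hk := D.k_pos
  have hG := D.ℓ_g_pos
  have hq0 : 0 < |D.q| := abs_pos.2 hq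
  -- `Q δ` is the value of `⟨g, S f · R η⟩` along the curve, with `Q 0 = q`
  set Q : ℝ → ℝ := fun δ => D.ℓ (D.b₁₂ (ψ δ).2.1 (ψ δ).2.2) with hQ
  have hQ0 : Q 0 = D.q := by simp [hQ, hψ0, base, q]
  have hQd : DifferentiableAt ℝ Q 0 := by simp only [hQ]; fun_prop
  obtain ⟨c₁, hc₁, hψb⟩ := hψd.hasFDerivAt.isBigO_sub.exists_pos
  obtain ⟨c₂, hc₂, hQb⟩ := hQd.hasFDerivAt.isBigO_sub.exists_pos
  rw [Asymptotics.isBigOWith_iff] at hψb hQb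
  simp only [hψ0, hQ0, sub_zero, Real.norm_eq_abs] at hψb hQb
  have hQc : ∀ᶠ δ in 𝓝 (0 : ℝ), |Q δ - D.q| < |D.q| / 2 := by
    have h := hQd.continuousAt.tendsto.eventually (Metric.ball_mem_nhds (Q 0) (half_pos hq0))
    simpa [hQ0, Real.dist_eq] using h
  have hψn : ∀ᶠ δ in 𝓝 (0 : ℝ), ‖ψ δ‖ < ‖D.base‖ + 1 := by
    have h := hψd.continuousAt.norm.tendsto.eventually (gt_mem_nhds (lt_add_one ‖ψ 0‖))
    simpa [hψ0] using h
  obtain ⟨ρ, hρ, hρu⟩ := Metric.eventually_nhds_iff_ball.1 hψu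
  obtain ⟨r, hr, hrb⟩ := D.blowUp_near_base hρ
  obtain ⟨ε, hε, hall⟩ := Metric.eventually_nhds_iff_ball.1
    (hψz.and (hψb.and (hQb.and (hQc.and hψn))))
  set B := ‖D.base‖ + 1 with hB
  have hB1 : 0 < B := by positivity
  set c₃ := D.k * (3 / 2 * |D.q|) / D.ℓ D.g with hc₃
  have hc₃0 : 0 < c₃ := by positivity
  refine ⟨c₁ * B + √c₁ * B + D.k * c₂ * c₃ / D.ℓ D.g, min (min ε r) ρ, r,
    fun δ => (ψ δ).1 • (ψ δ).2.1, fun δ => √(ψ δ).1 • (ψ δ).2.2,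
    by positivity, by positivity, hr, ?_⟩
  intro δ hδ hsign
  have hδε : |δ| < ε := hδ.trans_le ((min_le_left _ _).trans (min_le_left _ _))
  have hδr : |δ| < r := hδ.trans_le ((min_le_left _ _).trans (min_le_right _ _))
  have hδρ : |δ| < ρ := hδ.trans_le (min_le_right _ _)
  obtain ⟨hz, hb1, hb2, hb3, hb4⟩ := hall δ (by simpa [Real.dist_eq] using hδε)
  have hδ0 : δ ≠ 0 := by
    rintro rfl
    rw [sign_zero, eq_comm, SignType.neg_eq_zero_iff, sign_eq_zero_iff] at hsign
    exact hq hsign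
  generalize hψδ : ψ δ = v at *
  obtain ⟨α, f, η⟩ := v
  have hQδ : Q δ = D.ℓ (D.b₁₂ f η) := by simp only [hQ, hψδ]
  simp only at *
  -- the scalar bifurcation equation
  have hscal : δ * D.ℓ D.g + D.k * α * Q δ = 0 := by
    simp only [blowUp, Prod.mk_eq_zero, sub_eq_zero] at hz
    obtain ⟨h1, -, h3⟩ := hz
    have := congrArg D.ℓ h3
    simp only [map_sub, map_smul, D.ℓ_R, smul_eq_mul, h1] at this
    rw [hQδ]
    linarith
  have hqQ : 0 < D.q * Q δ := by
    rcases lt_or_gt_of_ne hq with h | h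
    · rw [abs_of_neg h] at hb3
      exact mul_pos_of_neg_of_neg h (by linarith [(abs_lt.1 hb3).2])
    · rw [abs_of_pos h] at hb3
      exact mul_pos h (by linarith [(abs_lt.1 hb3).1])
  have hδq : δ * D.q < 0 := by
    rw [← sign_eq_neg_one_iff, sign_mul, hsign]
    rcases lt_or_gt_of_ne hq with h | h
    · rw [sign_neg h]; rfl
    · rw [sign_pos h]; rfl
  have hα : 0 < α := by
    have h1 : D.k * α * (D.q * Q δ) = (-(δ * D.q)) * D.ℓ D.g := by linear_combination D.q * hscal
    have h2 : 0 < D.k * α * (D.q * Q δ) := by rw [h1]; exact mul_pos (by linarith) hG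
    exact pos_of_mul_pos_right (pos_of_mul_pos_left h2 hqQ.le) hk.le
  have hαb : α ≤ c₁ * |δ| := by
    refine (le_abs_self α).trans (le_trans ?_ hb1)
    simp [base]
  have hfb : ‖f‖ ≤ B := ((norm_fst_le (f, η)).trans (norm_snd_le (α, f, η))).trans hb4.le
  have hηb : ‖η‖ ≤ B := ((norm_snd_le (f, η)).trans (norm_snd_le (α, f, η))).trans hb4.le
  have hδα : |δ| ≤ c₃ * α := by
    have h1 : δ = -(D.k * α * Q δ) / D.ℓ D.g := by field_simp; linarith
    have h2 : |Q δ| ≤ 3 / 2 * |D.q| := by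
      have := abs_sub_abs_le_abs_sub (Q δ) D.q
      linarith
    conv_lhs => rw [h1]
    rw [abs_div, abs_neg, abs_mul, abs_mul, abs_of_pos hk, abs_of_pos hα, abs_of_pos hG, hc₃]
    calc D.k * α * |Q δ| / D.ℓ D.g ≤ D.k * α * (3 / 2 * |D.q|) / D.ℓ D.g := by gcongr
      _ = _ := by ring
  set a := √α with ha
  have ha0 : 0 < a := Real.sqrt_pos.2 hα
  have hasq : a ^ 2 = α := Real.sq_sqrt hα.le
  obtain ⟨hsol, hl⟩ := D.isSol_of_blowUp (δ := δ) (a := a) (f := f) (η := η) (by rw [hasq]; exact hz)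
  rw [hasq] at hsol
  have hC1 : c₁ * B ≤ c₁ * B + √c₁ * B + D.k * c₂ * c₃ / D.ℓ D.g := by
    have : 0 ≤ √c₁ * B + D.k * c₂ * c₃ / D.ℓ D.g := by positivity
    linarith
  have hC2 : √c₁ * B ≤ c₁ * B + √c₁ * B + D.k * c₂ * c₃ / D.ℓ D.g := by
    have : 0 ≤ c₁ * B + D.k * c₂ * c₃ / D.ℓ D.g := by positivity
    linarith
  have hC3 : D.k * c₂ * c₃ / D.ℓ D.g ≤ c₁ * B + √c₁ * B + D.k * c₂ * c₃ / D.ℓ D.g := by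
    have : 0 ≤ c₁ * B + √c₁ * B := by positivity
    linarith
  simp only [hψδ, ← ha]
  refine ⟨⟨hsol, by rw [hl]; positivity, ?_, ?_, ?_⟩, ?_⟩
  · rw [norm_smul, Real.norm_of_nonneg hα.le]
    calc α * ‖f‖ ≤ (c₁ * |δ|) * B := by gcongr
      _ = c₁ * B * |δ| := by ring
      _ ≤ _ := by gcongr
  · rw [norm_smul, Real.norm_of_nonneg ha0.le]
    calc a * ‖η‖ ≤ (√c₁ * √|δ|) * B := by
          gcongr
          rw [ha, ← Real.sqrt_mul hc₁.le]
          exact Real.sqrt_le_sqrt hαb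
      _ = √c₁ * B * √|δ| := by ring
      _ ≤ _ := by gcongr
  · rw [hl, mul_div_cancel_right₀ _ hG.ne', hasq, show a ^ 4 = α ^ 2 by rw [← hasq]; ring]
    have h1 : δ - -D.k * α * (D.q / D.ℓ D.g) = -(D.k * α * (Q δ - D.q)) / D.ℓ D.g := by
      field_simp
      linarith
    rw [h1, abs_div, abs_neg, abs_mul, abs_mul, abs_of_pos hk, abs_of_pos hα, abs_of_pos hG]
    calc D.k * α * |Q δ - D.q| / D.ℓ D.g ≤ D.k * α * (c₂ * (c₃ * α)) / D.ℓ D.g := by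
          gcongr
          exact hb2.trans (by gcongr)
      _ = D.k * c₂ * c₃ / D.ℓ D.g * α ^ 2 := by ring
      _ ≤ _ := by gcongr
  · intro F' θ' hsol' hθ' hF' ha'
    set a' := D.ℓ θ' / D.ℓ D.g with ha'_def
    have hl' : D.ℓ θ' = a' * D.ℓ D.g := by rw [ha'_def]; field_simp
    obtain ⟨hne, h1, h2, h3⟩ := hrb δ a' F' θ' hsol' hθ' hl' hδr ha' hF'
    have hmem : (δ, a' ^ 2, (a' ^ 2)⁻¹ • F', a'⁻¹ • θ') ∈ Metric.ball ((0 : ℝ), D.base) ρ := by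
      simp only [base, Metric.mem_ball, Prod.dist_eq, max_lt_iff]
      refine ⟨by simpa [Real.dist_eq] using hδρ, by simpa [Real.dist_eq] using h1, ?_, ?_⟩
      · rwa [dist_eq_norm]
      · rwa [dist_eq_norm]
    have heq := hρu _ hmem (D.blowUp_of_isSol hsol' hl' hne)
    simp only [hψδ, Prod.mk.injEq] at heq
    obtain ⟨e1, e2, e3⟩ := heq
    have hne2 : a' ^ 2 ≠ 0 := by positivity
    refine ⟨?_, ?_⟩
    · rw [← e1, ← e2, smul_smul, mul_inv_cancel₀ hne2, one_smul]
    · have h4 : θ' = a' • η := by rw [← e3, smul_smul, mul_inv_cancel₀ hne, one_smul]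
      rw [h4, ← neg_smul]
      have h5 : a' = a ∨ a' = -a := sq_eq_sq_iff_eq_or_eq_neg.1 (by rw [e1, hasq])
      rcases h5 with h5 | h5
      · exact Or.inl (by rw [h5])
      · exact Or.inr (by rw [h5])

end BifurcationData

end Abstract

/-! ### Absolutely continuous functions -/

section Primitives

open Set Topology

/-- `f` is a primitive of the locally integrable function `f'`: the absolutely continuous
functions, with their almost everywhere derivative. -/
def IsPrim (f f' : ℝ → ℝ) : Prop :=
  LocallyIntegrable f' ∧ ∀ x, f x = f 0 + ∫ t in (0 : ℝ)..x, f' t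

theorem _root_.MeasureTheory.LocallyIntegrable.intervalIntegrable_of_real {f : ℝ → ℝ}
    (hf : LocallyIntegrable f) (a b : ℝ) : IntervalIntegrable f volume a b :=
  intervalIntegrable_iff.2
    ((hf.integrableOn_isCompact isCompact_uIcc).mono_set uIoc_subset_uIcc)

namespace IsPrim

variable {f f' g g' : ℝ → ℝ}

theorem integral_eq_sub (hf : IsPrim f f') (a b : ℝ) : ∫ t in a..b, f' t = f b - f a := by
  rw [hf.2 a, hf.2 b, ← intervalIntegral.integral_add_adjacent_intervals
    (hf.1.intervalIntegrable_of_real 0 a) (hf.1.intervalIntegrable_of_real a b)]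
  ring

theorem continuous (hf : IsPrim f f') : Continuous f := by
  rw [show f = fun x => f 0 + ∫ t in (0 : ℝ)..x, f' t from funext hf.2]
  exact continuous_const.add (intervalIntegral.continuous_primitive hf.1.intervalIntegrable_of_real 0)

theorem ae_hasDerivAt (hf : IsPrim f f') : ∀ᵐ x, HasDerivAt f (f' x) x := by
  filter_upwards [_root_.LocallyIntegrable.ae_hasDerivAt_integral hf.1] with x hx
  rw [show f = fun x => f 0 + ∫ t in (0 : ℝ)..x, f' t from funext hf.2]
  exact (hx 0).const_add _

theorem absolutelyContinuous (hf : IsPrim f f') (b : ℝ) :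
    AbsolutelyContinuousOnInterval f 0 b := by
  have h := (hf.1.intervalIntegrable_of_real 0 b).absolutelyContinuousOnInterval_intervalIntegral
    left_mem_uIcc
  have hc : AbsolutelyContinuousOnInterval (fun _ : ℝ => f 0) 0 b :=
    (LipschitzWith.const (f 0)).lipschitzOnWith.absolutelyContinuousOnInterval
  have := hc.add h
  rwa [show f = (fun _ : ℝ => f 0) + fun x => ∫ t in (0 : ℝ)..x, f' t from funext hf.2]

theorem congr (hf : IsPrim f f') (h : f' =ᵐ[volume] g') : IsPrim f g' := by
  refine ⟨hf.1.congr h, fun x => ?_⟩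
  rw [hf.2 x, intervalIntegral.integral_congr_ae (h.mono fun t ht _ => ht)]

theorem congr_fun (hf : IsPrim f f') (h : ∀ x, f' x = g' x) : IsPrim f g' :=
  hf.congr (Eventually.of_forall h)

theorem of_hasDerivAt (hf : ∀ x, HasDerivAt f (f' x) x) (hc : Continuous f') : IsPrim f f' := by
  refine ⟨hc.locallyIntegrable, fun x => ?_⟩
  rw [intervalIntegral.integral_eq_sub_of_hasDerivAt (fun t _ => hf t) (hc.intervalIntegrable 0 x)]
  ring

theorem primitive (hf : LocallyIntegrable f') (C : ℝ) :
    IsPrim (fun x => C + ∫ t in (0 : ℝ)..x, f' t) f' :=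
  ⟨hf, fun x => by simp⟩

theorem add (hf : IsPrim f f') (hg : IsPrim g g') :
    IsPrim (fun x => f x + g x) (fun x => f' x + g' x) := by
  refine ⟨hf.1.add hg.1, fun x => ?_⟩
  beta_reduce
  rw [hf.2 x, hg.2 x, intervalIntegral.integral_add (hf.1.intervalIntegrable_of_real 0 x)
    (hg.1.intervalIntegrable_of_real 0 x)]
  ring

theorem const_mul (hf : IsPrim f f') (a : ℝ) : IsPrim (fun x => a * f x) (fun x => a * f' x) := by
  refine ⟨LocallyIntegrable.continuous_mul continuous_const hf.1, fun x => ?_⟩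
  beta_reduce
  rw [hf.2 x, intervalIntegral.integral_const_mul]
  ring

theorem sub (hf : IsPrim f f') (hg : IsPrim g g') :
    IsPrim (fun x => f x - g x) (fun x => f' x - g' x) := by
  have h := (hf.add (hg.const_mul (-1)))
  simpa [sub_eq_add_neg] using h

theorem mul (hf : IsPrim f f') (hg : IsPrim g g') :
    IsPrim (fun x => f x * g x) (fun x => f' x * g x + f x * g' x) := by
  refine ⟨?_, fun x => ?_⟩
  · refine LocallyIntegrable.add ?_ (LocallyIntegrable.continuous_mul hf.continuous hg.1)
    simpa only [mul_comm] using LocallyIntegrable.continuous_mul hg.continuous hf.1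
  · have h := (hf.absolutelyContinuous x).integral_deriv_mul_eq_sub (hg.absolutelyContinuous x)
    rw [← sub_eq_iff_eq_add', ← h]
    refine intervalIntegral.integral_congr_ae ?_
    filter_upwards [hf.ae_hasDerivAt, hg.ae_hasDerivAt] with t h1 h2 _
    rw [h1.deriv, h2.deriv]

/-- If `f` and `f'` are integrable then `f` vanishes at `±∞`, so `f'` has zero integral. -/
theorem integral_eq_zero (hf : IsPrim f f') (hi : Integrable f) (hi' : Integrable f') :
    ∫ x, f' x = 0 := by
  have htop : Tendsto f atTop (𝓝 (f 0 + ∫ t in Ioi (0 : ℝ), f' t)) := by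
    rw [show f = fun x => f 0 + ∫ t in (0 : ℝ)..x, f' t from funext hf.2]
    simpa using (intervalIntegral_tendsto_integral_Ioi 0 hi'.integrableOn tendsto_id).const_add (f 0)
  have hbot : Tendsto f atBot (𝓝 (f 0 - ∫ t in Iic (0 : ℝ), f' t)) := by
    have h : f = fun x => f 0 - ∫ t in x..(0 : ℝ), f' t := by
      funext x
      rw [hf.integral_eq_sub]
      ring
    rw [h]
    simpa using (intervalIntegral_tendsto_integral_Iic 0 hi'.integrableOn tendsto_id).const_sub (f 0)
  have e1 : f 0 + ∫ t in Ioi (0 : ℝ), f' t = 0 := by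
    have : IntegrableAtFilter f atTop := ⟨Ioi 0, Ioi_mem_atTop _, hi.integrableOn⟩
    refine this.eq_zero_of_tendsto (fun s hs => ?_) htop
    obtain ⟨b, hb⟩ := mem_atTop_sets.1 hs
    rw [← top_le_iff, ← Real.volume_Ici (a := b)]
    exact measure_mono hb
  have e2 : f 0 - ∫ t in Iic (0 : ℝ), f' t = 0 := by
    have : IntegrableAtFilter f atBot := ⟨Iic 0, Iic_mem_atBot _, hi.integrableOn⟩
    refine this.eq_zero_of_tendsto (fun s hs => ?_) hbot
    obtain ⟨b, hb⟩ := mem_atBot_sets.1 hs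
    rw [← top_le_iff, ← Real.volume_Iic (a := b)]
    exact measure_mono hb
  rw [← intervalIntegral.integral_Iic_add_Ioi hi'.integrableOn hi'.integrableOn (b := 0)]
  linarith

theorem hasWeakDeriv (hf : IsPrim f f') : HasWeakDeriv f f' := by
  refine ⟨hf.continuous.locallyIntegrable, hf.1, fun φ hφ hs => ?_⟩
  have hφd : IsPrim φ (deriv φ) := of_hasDerivAt
    (fun x => (hφ.differentiable (by simp) x).hasDerivAt) (hφ.continuous_deriv (by simp))
  have i1 : Integrable (fun x => f x * φ x) :=
    (hf.continuous.mul hφ.continuous).integrable_of_hasCompactSupport hs.mul_left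
  have i2 : Integrable (fun x => f' x * φ x) := by
    have := hf.1.integrable_smul_left_of_hasCompactSupport hφ.continuous hs
    simpa only [smul_eq_mul, mul_comm] using this
  have i3 : Integrable (fun x => f x * deriv φ x) :=
    (hf.continuous.mul (hφ.continuous_deriv (by simp))).integrable_of_hasCompactSupport
      hs.deriv.mul_left
  have h := (hf.mul hφd).integral_eq_zero i1 (i2.add i3)
  rw [integral_add i2 i3] at h
  linarith

end IsPrim

end Primitives

/-! ### Weak derivatives on the line -/

section WeakDerivatives

open Set

variable {f f' g g' h : ℝ → ℝ}

theorem HasWeakDeriv.ae_unique (h1 : HasWeakDeriv f g) (h2 : HasWeakDeriv f g') :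
    g =ᵐ[volume] g' := by
  refine ae_eq_of_integral_contDiff_smul_eq h1.2.1 h2.2.1 fun φ hφ hs => ?_
  have := (h1.2.2 φ hφ hs).symm.trans (h2.2.2 φ hφ hs)
  simpa only [smul_eq_mul, mul_comm, neg_inj] using this

theorem HasWeakDeriv.congr (h1 : HasWeakDeriv f g) (hf : f =ᵐ[volume] f') (hg : g =ᵐ[volume] g') :
    HasWeakDeriv f' g' := by
  refine ⟨h1.1.congr hf, h1.2.1.congr hg, fun φ hφ hs => ?_⟩
  rw [integral_congr_ae (g := fun x => f x * deriv φ x) (hf.mono fun x hx => by simp only [hx]),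
    integral_congr_ae (f := fun x => g' x * φ x) (g := fun x => g x * φ x)
      (hg.mono fun x hx => by simp only [hx])]
  exact h1.2.2 φ hφ hs

theorem weakDeriv_ae_eq (h1 : HasWeakDeriv f g) : weakDeriv f =ᵐ[volume] g := by
  have hex : ∃ g, HasWeakDeriv f g := ⟨g, h1⟩
  rw [weakDeriv, dif_pos hex]
  exact hex.choose_spec.ae_unique h1

/-- Du Bois-Reymond: a function with zero weak derivative is almost everywhere constant. A test
function `φ` is compared with `(∫ φ) ψ`, for a fixed bump `ψ` of integral one: the difference is
the derivative of a test function. -/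
theorem HasWeakDeriv.ae_const (h1 : HasWeakDeriv f 0) : ∃ C, ∀ᵐ x, f x = C := by
  let ψ₀ : ContDiffBump (0 : ℝ) := ⟨1, 2, by norm_num, by norm_num⟩
  let ψ : ℝ → ℝ := ψ₀.normed volume
  have hψ : ContDiff ℝ ∞ ψ := ψ₀.contDiff_normed
  have hψs : HasCompactSupport ψ := ψ₀.hasCompactSupport_normed
  have hψi : ∫ x, ψ x = 1 := ψ₀.integral_normed
  refine ⟨∫ x, f x * ψ x, ?_⟩
  refine ae_eq_of_integral_contDiff_smul_eq h1.1 (locallyIntegrable_const _) fun φ hφ hs => ?_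
  set c := ∫ x, φ x with hc
  let η : ℝ → ℝ := fun x => φ x - c * ψ x
  have hη : ContDiff ℝ ∞ η := hφ.sub (contDiff_const.mul hψ)
  have hηs : HasCompactSupport η := hs.sub hψs.mul_left
  have iφ := hφ.continuous.integrable_of_hasCompactSupport (μ := volume) hs
  have iψ := hψ.continuous.integrable_of_hasCompactSupport (μ := volume) hψs
  have iη := hη.continuous.integrable_of_hasCompactSupport (μ := volume) hηs
  have hη0 : ∫ x, η x = 0 := by
    rw [integral_sub iφ (iψ.const_mul c), integral_const_mul, hψi, ← hc]
    ring
  obtain ⟨R, hR⟩ := hηs.isCompact.isBounded.subset_closedBall 0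
  have hηR : ∀ x, R < |x| → η x = 0 := fun x hx => by
    refine image_eq_zero_of_notMem_tsupport fun hmem => ?_
    have := hR hmem
    rw [mem_closedBall_zero_iff, Real.norm_eq_abs] at this
    linarith
  let χ : ℝ → ℝ := fun x => ∫ t in Iic x, η t
  have hχ' : ∀ x, HasDerivAt χ (η x) x := by
    intro x
    have h2 : χ = fun y => (∫ t in Iic (0 : ℝ), η t) + ∫ t in (0 : ℝ)..y, η t := by
      funext y
      rw [← intervalIntegral.integral_Iic_sub_Iic iη.integrableOn iη.integrableOn]
      simp only [χ]
      ring
    rw [h2]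
    exact (intervalIntegral.integral_hasDerivAt_right (hη.continuous.intervalIntegrable _ _)
      (hη.continuous.stronglyMeasurableAtFilter _ _) hη.continuous.continuousAt).const_add _
  have hχd : deriv χ = η := funext fun x => (hχ' x).deriv
  have hχ : ContDiff ℝ ∞ χ := by
    rw [contDiff_infty_iff_deriv, hχd]
    exact ⟨fun x => (hχ' x).differentiableAt, hη⟩
  have hχs : HasCompactSupport χ := by
    refine HasCompactSupport.of_support_subset_isCompact (isCompact_Icc (a := -R) (b := R)) ?_
    intro x hx
    by_contra hxR
    refine hx ?_
    rw [mem_Icc, not_and_or, not_le, not_le] at hxR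
    rcases hxR with h2 | h2
    · refine setIntegral_eq_zero_of_forall_eq_zero fun t ht => hηR t ?_
      have := neg_abs_le t
      have := mem_Iic.1 ht
      linarith
    · have h3 : ∫ t in Ioi x, η t = 0 := by
        refine setIntegral_eq_zero_of_forall_eq_zero fun t ht => hηR t ?_
        have := le_abs_self t
        have := mem_Ioi.1 ht
        linarith
      have h4 := intervalIntegral.integral_Iic_add_Ioi (f := η) (b := x) iη.integrableOn
        iη.integrableOn
      rw [h3, hη0, add_zero] at h4
      exact h4
  have h2 := h1.2.2 χ hχ hχs
  rw [hχd] at h2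
  have i1 : Integrable (fun x => f x * φ x) := by
    have := h1.1.integrable_smul_left_of_hasCompactSupport hφ.continuous hs
    simpa only [smul_eq_mul, mul_comm] using this
  have i2 : Integrable (fun x => f x * ψ x) := by
    have := h1.1.integrable_smul_left_of_hasCompactSupport hψ.continuous hψs
    simpa only [smul_eq_mul, mul_comm] using this
  have h3 : ∫ x, f x * η x = (∫ x, f x * φ x) - c * ∫ x, f x * ψ x := by
    rw [← integral_const_mul, ← integral_sub i1 (i2.const_mul c)]
    refine integral_congr_ae (Eventually.of_forall fun x => ?_)
    simp only [η]
    ring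
  simp only [smul_eq_mul]
  rw [integral_mul_const, ← hc]
  simp only [mul_comm (φ _)]
  simp only [Pi.zero_apply, zero_mul, integral_zero, neg_zero] at h2
  linarith

/-- A function with a weak derivative is almost everywhere equal to a primitive of it. -/
theorem HasWeakDeriv.exists_isPrim (h1 : HasWeakDeriv f g) :
    ∃ f₀, IsPrim f₀ g ∧ f =ᵐ[volume] f₀ := by
  have h2 := (IsPrim.primitive h1.2.1 0).hasWeakDeriv
  have h3 : HasWeakDeriv (fun x => f x - (0 + ∫ t in (0 : ℝ)..x, g t)) 0 := by
    refine ⟨h1.1.sub h2.1, locallyIntegrable_zero, fun φ hφ hs => ?_⟩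
    have hφ' := hφ.continuous_deriv (by simp)
    have i1 : Integrable (fun x => f x * deriv φ x) := by
      have := h1.1.integrable_smul_left_of_hasCompactSupport hφ' hs.deriv
      simpa only [smul_eq_mul, mul_comm] using this
    have i2 : Integrable (fun x => (0 + ∫ t in (0 : ℝ)..x, g t) * deriv φ x) := by
      have := h2.1.integrable_smul_left_of_hasCompactSupport hφ' hs.deriv
      simpa only [smul_eq_mul, mul_comm] using this
    simp only [sub_mul]
    rw [integral_sub i1 i2, h1.2.2 φ hφ hs, h2.2.2 φ hφ hs]
    simp
  obtain ⟨C, hC⟩ := h3.ae_const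
  refine ⟨fun x => C + ∫ t in (0 : ℝ)..x, g t, IsPrim.primitive h1.2.1 C, ?_⟩
  filter_upwards [hC] with x hx
  linarith

end WeakDerivatives

/-! ### Functions in `H²(ℝ)` -/

section SobolevSpace

open Set

theorem _root_.MeasureTheory.MemLp.integrable_mul_two {f g : ℝ → ℝ} (hf : MemLp f 2)
    (hg : MemLp g 2) : Integrable (fun x => f x * g x) := by
  have := hf.integrable_mul hg (p := 2) (q := 2)
  exact this

theorem normL2_sq (f : ℝ → ℝ) : normL2 f ^ 2 = ∫ x, f x * f x :=
  Real.sq_sqrt (integral_nonneg fun x => mul_self_nonneg (f x))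

theorem innerL2_congr {f f' g g' : ℝ → ℝ} (hf : f =ᵐ[volume] f') (hg : g =ᵐ[volume] g') :
    innerL2 f g = innerL2 f' g' := by
  refine integral_congr_ae ?_
  filter_upwards [hf, hg] with x h1 h2
  rw [h1, h2]

theorem normL2_congr {f g : ℝ → ℝ} (h : f =ᵐ[volume] g) : normL2 f = normL2 g := by
  rw [normL2, normL2, innerL2_congr h h]

theorem innerL2_self_nonneg (f : ℝ → ℝ) : 0 ≤ innerL2 f f :=
  integral_nonneg fun x => mul_self_nonneg (f x)

/-- The continuously differentiable representative of an `H²` function, with its derivative `f₁`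
and the almost everywhere second derivative `f₂`. -/
structure IsH2 (f f₁ f₂ : ℝ → ℝ) : Prop where
  prim : IsPrim f f₁
  prim₁ : IsPrim f₁ f₂
  memLp : MemLp f 2
  memLp₁ : MemLp f₁ 2
  memLp₂ : MemLp f₂ 2

namespace IsH2

variable {f f₁ f₂ g g₁ g₂ w : ℝ → ℝ}

theorem memH2 (hf : IsH2 f f₁ f₂) (hw : w =ᵐ[volume] f) : MemH2 w :=
  ⟨f₁, f₂, hf.prim.hasWeakDeriv.congr hw.symm .rfl, hf.prim₁.hasWeakDeriv,
    hf.memLp.ae_eq hw.symm, hf.memLp₁, hf.memLp₂⟩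

theorem weakDeriv_ae_eq (hf : IsH2 f f₁ f₂) (hw : w =ᵐ[volume] f) :
    weakDeriv w =ᵐ[volume] f₁ :=
  KdVLS.weakDeriv_ae_eq (hf.prim.hasWeakDeriv.congr hw.symm .rfl)

theorem weakDeriv₂_ae_eq (hf : IsH2 f f₁ f₂) (hw : w =ᵐ[volume] f) :
    weakDeriv₂ w =ᵐ[volume] f₂ :=
  KdVLS.weakDeriv_ae_eq (hf.prim₁.hasWeakDeriv.congr (hf.weakDeriv_ae_eq hw).symm .rfl)

theorem normH2_eq (hf : IsH2 f f₁ f₂) (hw : w =ᵐ[volume] f) :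
    normH2 w = √(innerL2 f f + innerL2 f₁ f₁ + innerL2 f₂ f₂) := by
  rw [normH2, normL2_congr hw, normL2_congr (hf.weakDeriv_ae_eq hw),
    normL2_congr (hf.weakDeriv₂_ae_eq hw), normL2_sq, normL2_sq, normL2_sq]
  rfl

theorem add (hf : IsH2 f f₁ f₂) (hg : IsH2 g g₁ g₂) :
    IsH2 (fun x => f x + g x) (fun x => f₁ x + g₁ x) (fun x => f₂ x + g₂ x) :=
  ⟨hf.prim.add hg.prim, hf.prim₁.add hg.prim₁, hf.memLp.add hg.memLp, hf.memLp₁.add hg.memLp₁,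
    hf.memLp₂.add hg.memLp₂⟩

theorem const_mul (hf : IsH2 f f₁ f₂) (a : ℝ) :
    IsH2 (fun x => a * f x) (fun x => a * f₁ x) (fun x => a * f₂ x) :=
  ⟨hf.prim.const_mul a, hf.prim₁.const_mul a, hf.memLp.const_mul a, hf.memLp₁.const_mul a,
    hf.memLp₂.const_mul a⟩

/-- The second derivative is symmetric: the Wronskian `f₁ g - f g₁` vanishes at `±∞`. -/
theorem innerL2_symm (hf : IsH2 f f₁ f₂) (hg : IsH2 g g₁ g₂) : innerL2 f₂ g = innerL2 f g₂ := by
  have i1 := hf.memLp₂.integrable_mul_two hg.memLp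
  have i2 := hf.memLp.integrable_mul_two hg.memLp₂
  have h := ((hf.prim₁.mul hg.prim).sub (hf.prim.mul hg.prim₁)).congr_fun
    (g' := fun x => f₂ x * g x - f x * g₂ x) (fun x => by ring)
  have h0 := h.integral_eq_zero
    ((hf.memLp₁.integrable_mul_two hg.memLp).sub (hf.memLp.integrable_mul_two hg.memLp₁))
    (i1.sub i2)
  rw [integral_sub i1 i2, sub_eq_zero] at h0
  exact h0

theorem energy (hf : IsH2 f f₁ f₂) : innerL2 f₁ f₁ = -innerL2 f f₂ := by
  have i1 := hf.memLp₁.integrable_mul_two hf.memLp₁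
  have i2 := hf.memLp.integrable_mul_two hf.memLp₂
  have h0 := (hf.prim.mul hf.prim₁).integral_eq_zero (hf.memLp.integrable_mul_two hf.memLp₁)
    (i1.add i2)
  rw [integral_add i1 i2] at h0
  rw [innerL2, innerL2]
  linarith

theorem energy_le (hf : IsH2 f f₁ f₂) : innerL2 f₁ f₁ ≤ innerL2 f f + innerL2 f₂ f₂ := by
  have i0 := hf.memLp.integrable_mul_two hf.memLp
  have i1 := hf.memLp.integrable_mul_two hf.memLp₂
  have i2 := hf.memLp₂.integrable_mul_two hf.memLp₂
  rw [hf.energy, innerL2, innerL2, innerL2, ← integral_neg, ← integral_add i0 i2]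
  refine integral_mono i1.neg (i0.add i2) fun x => ?_
  beta_reduce
  nlinarith [sq_nonneg (f x + f₂ x), mul_self_nonneg (f x), mul_self_nonneg (f₂ x)]

/-- The one-dimensional Sobolev inequality. -/
theorem sq_le (hf : IsH2 f f₁ f₂) (x : ℝ) : f x ^ 2 ≤ 2 * innerL2 f f + innerL2 f₁ f₁ := by
  have i0 := hf.memLp.integrable_mul_two hf.memLp
  have i1 := hf.memLp₁.integrable_mul_two hf.memLp₁
  have hsq := hf.prim.mul hf.prim
  set E := innerL2 f f + innerL2 f₁ f₁ with hE
  have hEi : E = ∫ t, (f t * f t + f₁ t * f₁ t) := (integral_add i0 i1).symm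
  have h1 : ∀ y ∈ Icc x (x + 1), f x ^ 2 ≤ f y * f y + E := by
    intro y hy
    have h2 := hsq.integral_eq_sub x y
    have h3 : |∫ t in x..y, (f₁ t * f t + f t * f₁ t)| ≤ E := by
      rw [intervalIntegral.integral_of_le hy.1, hEi]
      have i2 : Integrable (fun t => f₁ t * f t + f t * f₁ t) :=
        (hf.memLp₁.integrable_mul_two hf.memLp).add (hf.memLp.integrable_mul_two hf.memLp₁)
      refine (abs_integral_le_integral_abs).trans ((setIntegral_le_integral i2.abs
        (Eventually.of_forall fun t => abs_nonneg _)).trans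
          (integral_mono i2.abs (i0.add i1) fun t => ?_))
      refine abs_le.2 ⟨?_, ?_⟩
      · nlinarith [sq_nonneg (f t + f₁ t)]
      · nlinarith [sq_nonneg (f t - f₁ t)]
    rw [h2] at h3
    have := (abs_le.1 h3).1
    nlinarith
  have h4 : ∫ _ in x..(x + 1), f x ^ 2 ≤ ∫ y in x..(x + 1), (f y * f y + E) := by
    refine intervalIntegral.integral_mono_on (by linarith) (by simp) ?_ h1
    exact (hsq.continuous.add continuous_const).intervalIntegrable _ _
  have h5 : ∫ y in x..(x + 1), f y * f y ≤ innerL2 f f := by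
    rw [intervalIntegral.integral_of_le (by linarith)]
    exact setIntegral_le_integral i0 (Eventually.of_forall fun t => mul_self_nonneg _)
  rw [intervalIntegral.integral_add (hsq.continuous.intervalIntegrable _ _) (by simp)] at h4
  simp only [intervalIntegral.integral_const, add_sub_cancel_left, one_smul] at h4
  linarith

end IsH2

theorem MemH2.exists_isH2 {w : ℝ → ℝ} (hw : MemH2 w) :
    ∃ f f₁ f₂, IsH2 f f₁ f₂ ∧ w =ᵐ[volume] f := by
  obtain ⟨w₁, w₂, h1, h2, hm, hm1, hm2⟩ := hw
  obtain ⟨f₁, hf₁, he₁⟩ := h2.exists_isPrim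
  obtain ⟨f, hf, he⟩ := (h1.congr .rfl he₁).exists_isPrim
  exact ⟨f, f₁, w₂, ⟨hf, hf₁, hm.ae_eq he, hm1.ae_eq he₁, hm2⟩, he⟩

end SobolevSpace

/-! ### The Schur test for exponential kernels -/

section Schur

open Set
open scoped ENNReal

theorem integrable_exp_neg_mul_abs {κ : ℝ} (hκ : 0 < κ) :
    Integrable fun x : ℝ => Real.exp (-(κ * |x|)) := by
  rw [← integrableOn_univ, ← Iic_union_Ioi (a := (0 : ℝ))]
  refine IntegrableOn.union ?_ ?_
  · refine (integrableOn_exp_mul_Iic hκ 0).congr_fun (fun x hx => ?_) measurableSet_Iic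
    rw [abs_of_nonpos (mem_Iic.1 hx)]
    ring_nf
  · refine (integrableOn_exp_mul_Ioi (neg_neg_of_pos hκ) 0).congr_fun (fun x hx => ?_)
      measurableSet_Ioi
    rw [abs_of_pos (mem_Ioi.1 hx)]
    ring_nf

/-- Young's inequality `L¹ * L² ⊆ L²`, for a square `h²` as the integrable kernel. -/
theorem lintegral_conv_sq_lt_top {h F : ℝ → ℝ≥0∞} (hh : Measurable h) (hF : AEMeasurable F)
    (hi : ∫⁻ x, h x ^ 2 ≠ ⊤) (hFi : ∫⁻ x, F x ^ 2 ≠ ⊤) :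
    ∫⁻ x, (∫⁻ t, h (x - t) ^ 2 * F t) ^ 2 < ⊤ := by
  set A := ∫⁻ x, h x ^ 2 with hA
  have hk : ∀ x, ∫⁻ t, h (x - t) ^ 2 = A := fun x =>
    lintegral_sub_left_eq_self (fun t => h t ^ 2) x
  have hk' : ∀ t, ∫⁻ x, h (x - t) ^ 2 = A := fun t =>
    lintegral_sub_right_eq_self (fun x => h x ^ 2) t
  -- Cauchy–Schwarz, splitting the kernel as `h · h`
  have hcs : ∀ x, (∫⁻ t, h (x - t) ^ 2 * F t) ^ 2 ≤ A * ∫⁻ t, h (x - t) ^ 2 * F t ^ 2 := by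
    intro x
    have hm : AEMeasurable (fun t => h (x - t)) := by fun_prop
    have h1 := ENNReal.lintegral_mul_le_Lp_mul_Lq volume (Real.HolderConjugate.two_two) hm
      (hm.mul hF)
    simp only [Pi.mul_apply, ENNReal.rpow_two, mul_pow, hk] at h1
    calc (∫⁻ t, h (x - t) ^ 2 * F t) ^ 2
        = (∫⁻ t, h (x - t) * (h (x - t) * F t)) ^ 2 := by simp only [sq, mul_assoc]
      _ ≤ (A ^ (1 / 2 : ℝ) * (∫⁻ t, h (x - t) ^ 2 * F t ^ 2) ^ (1 / 2 : ℝ)) ^ 2 := by gcongr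
      _ = A * ∫⁻ t, h (x - t) ^ 2 * F t ^ 2 := by
          rw [mul_pow, ← ENNReal.rpow_two, ← ENNReal.rpow_two, ← ENNReal.rpow_mul,
            ← ENNReal.rpow_mul]
          norm_num
  calc ∫⁻ x, (∫⁻ t, h (x - t) ^ 2 * F t) ^ 2
      ≤ ∫⁻ x, A * ∫⁻ t, h (x - t) ^ 2 * F t ^ 2 := lintegral_mono hcs
    _ = A * ∫⁻ x, ∫⁻ t, h (x - t) ^ 2 * F t ^ 2 := lintegral_const_mul' _ _ hi
    _ = A * ∫⁻ t, ∫⁻ x, h (x - t) ^ 2 * F t ^ 2 := by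
        rw [lintegral_lintegral_swap]
        exact ((hh.comp (measurable_fst.sub measurable_snd)).pow_const 2).aemeasurable.mul
          ((hF.pow_const 2).comp_snd)
    _ = A * (A * ∫⁻ t, F t ^ 2) := by
        congr 1
        rw [← lintegral_const_mul' _ _ hi]
        refine lintegral_congr fun t => ?_
        rw [lintegral_mul_const _ (by fun_prop), hk']
    _ < ⊤ := ENNReal.mul_lt_top hi.lt_top (ENNReal.mul_lt_top hi.lt_top hFi.lt_top)

/-- Schur test: integrals of an `L²` function against weights dominated by `e^{-κ|x - t|}` are
in `L²`. -/
theorem memLp_of_exp_kernel {y f : ℝ → ℝ} {κ C : ℝ} (hκ : 0 < κ) (hy : Continuous y)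
    (hf : MemLp f 2)
    (hb : ∀ x, ∃ (S : Set ℝ) (w : ℝ → ℝ), MeasurableSet S ∧
      (∀ t ∈ S, |w t| ≤ C * Real.exp (-(κ * |x - t|))) ∧ |y x| = |∫ t in S, w t * f t|) :
    MemLp y 2 := by
  rw [memLp_two_iff_integrable_sq hy.aestronglyMeasurable]
  refine ⟨(hy.pow 2).aestronglyMeasurable, ?_⟩
  let h : ℝ → ℝ≥0∞ := fun x => ENNReal.ofReal (Real.exp (-(κ / 2 * |x|)))
  have hh : Measurable h := by fun_prop
  have hsq : ∀ x, h x ^ 2 = ENNReal.ofReal (Real.exp (-(κ * |x|))) := fun x => by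
    rw [← ENNReal.ofReal_pow (Real.exp_pos _).le, ← Real.exp_nat_mul]
    congr 2
    push_cast
    ring
  have hi : ∫⁻ x, h x ^ 2 ≠ ⊤ := by
    simp only [hsq]
    exact (integrable_exp_neg_mul_abs hκ).lintegral_lt_top.ne
  have hfi : ∫⁻ x, ‖f x‖ₑ ^ 2 ≠ ⊤ := by
    have h1 := ((memLp_two_iff_integrable_sq hf.1).1 hf).2
    simpa only [HasFiniteIntegral, enorm_pow] using h1.ne
  have hmain := lintegral_conv_sq_lt_top hh hf.1.enorm hi hfi
  have hpt : ∀ x, ‖y x‖ₑ ≤ ENNReal.ofReal C * ∫⁻ t, h (x - t) ^ 2 * ‖f t‖ₑ := by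
    intro x
    obtain ⟨S, w, hS, hw, hyx⟩ := hb x
    have h1 : ‖y x‖ₑ = ‖∫ t in S, w t * f t‖ₑ := by
      rw [Real.enorm_eq_ofReal_abs, hyx, ← Real.enorm_eq_ofReal_abs]
    rw [h1, ← lintegral_const_mul' _ _ ENNReal.ofReal_ne_top]
    calc ‖∫ t in S, w t * f t‖ₑ ≤ ∫⁻ t in S, ‖w t * f t‖ₑ := enorm_integral_le_lintegral_enorm _
      _ ≤ ∫⁻ t in S, ENNReal.ofReal C * (h (x - t) ^ 2 * ‖f t‖ₑ) := by
          refine setLIntegral_mono' hS fun t ht => ?_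
          rw [enorm_mul, ← mul_assoc, hsq, ← ENNReal.ofReal_mul' (Real.exp_pos _).le,
            Real.enorm_eq_ofReal_abs (w t)]
          gcongr
          exact hw t ht
      _ ≤ _ := setLIntegral_le_lintegral _ _
  calc ∫⁻ x, ‖y x ^ 2‖ₑ
      ≤ ∫⁻ x, ENNReal.ofReal C ^ 2 * (∫⁻ t, h (x - t) ^ 2 * ‖f t‖ₑ) ^ 2 := by
        refine lintegral_mono fun x => ?_
        rw [enorm_pow, ← mul_pow]
        exact pow_le_pow_left' (hpt x) 2
    _ = ENNReal.ofReal C ^ 2 * ∫⁻ x, (∫⁻ t, h (x - t) ^ 2 * ‖f t‖ₑ) ^ 2 :=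
        lintegral_const_mul' _ _ (by finiteness)
    _ < ⊤ := ENNReal.mul_lt_top (by finiteness) hmain

end Schur

/-! ### Powers of the hyperbolic secant -/

section Sech

open Set

/-- The function `sechᵖ (b x)`. -/
noncomputable def sechPow (b p x : ℝ) : ℝ := (1 / Real.cosh (b * x)) ^ p

/-- The logarithmic derivative `-(sechᵖ (b x))' / sechᵖ (b x)`. -/
noncomputable def drift (b p x : ℝ) : ℝ := p * b * Real.tanh (b * x)

variable {b p : ℝ}

theorem sechPow_pos (b p x : ℝ) : 0 < sechPow b p x :=
  Real.rpow_pos_of_pos (by have := Real.cosh_pos (b * x); positivity) p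

theorem sechPow_neg (b p x : ℝ) : sechPow b p (-x) = sechPow b p x := by
  rw [sechPow, sechPow, mul_neg, Real.cosh_neg]

theorem sech_sq (x : ℝ) : (1 / Real.cosh x) ^ 2 = 1 - Real.tanh x ^ 2 := by
  have h1 := Real.cosh_pos x
  have h2 := Real.cosh_sq x
  rw [Real.tanh_eq_sinh_div_cosh]
  field_simp
  linarith

theorem hasDerivAt_tanh_mul (b x : ℝ) :
    HasDerivAt (fun x => Real.tanh (b * x)) (b * (1 - Real.tanh (b * x) ^ 2)) x := by
  have h1 := Real.cosh_pos (b * x)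
  have hb : HasDerivAt (fun x : ℝ => b * x) b x := by simpa using (hasDerivAt_id x).const_mul b
  have h := (hb.sinh).div hb.cosh h1.ne'
  simp only [Real.tanh_eq_sinh_div_cosh]
  refine h.congr_deriv ?_
  field_simp

theorem hasDerivAt_sechPow (b p x : ℝ) :
    HasDerivAt (sechPow b p) (-(drift b p x * sechPow b p x)) x := by
  have h1 := Real.cosh_pos (b * x)
  have hb : HasDerivAt (fun x : ℝ => b * x) b x := by simpa using (hasDerivAt_id x).const_mul b
  have h := ((hasDerivAt_const x (1 : ℝ)).div hb.cosh h1.ne').rpow_const (p := p)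
    (Or.inl (by simp only [Pi.div_apply]; positivity))
  refine h.congr_deriv ?_
  simp only [Pi.div_apply]
  rw [Real.rpow_sub_one (by positivity), drift, sechPow, Real.tanh_eq_sinh_div_cosh]
  field_simp
  ring

theorem continuous_tanh_mul (b : ℝ) : Continuous fun x => Real.tanh (b * x) :=
  continuous_iff_continuousAt.2 fun x => (hasDerivAt_tanh_mul b x).continuousAt

theorem continuous_drift (b p : ℝ) : Continuous (drift b p) :=
  continuous_const.mul (continuous_tanh_mul b)

theorem continuous_sechPow (b p : ℝ) : Continuous (sechPow b p) :=
  continuous_iff_continuousAt.2 fun x => (hasDerivAt_sechPow b p x).continuousAt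

theorem isPrim_tanh (b : ℝ) :
    IsPrim (fun x => Real.tanh (b * x)) (fun x => b * (1 - Real.tanh (b * x) ^ 2)) :=
  .of_hasDerivAt (hasDerivAt_tanh_mul b)
    (continuous_const.mul (continuous_const.sub ((continuous_tanh_mul b).pow 2)))

theorem isPrim_drift (b p : ℝ) :
    IsPrim (drift b p) (fun x => p * b ^ 2 * (1 - Real.tanh (b * x) ^ 2)) :=
  ((isPrim_tanh b).const_mul (p * b)).congr_fun fun x => by ring

theorem isPrim_sechPow (b p : ℝ) :
    IsPrim (sechPow b p) (fun x => -(drift b p x * sechPow b p x)) :=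
  .of_hasDerivAt (hasDerivAt_sechPow b p)
    ((continuous_drift b p).mul (continuous_sechPow b p)).neg

theorem isPrim_inv_sechPow (b p : ℝ) :
    IsPrim (fun x => (sechPow b p x)⁻¹) (fun x => drift b p x * (sechPow b p x)⁻¹) := by
  refine .of_hasDerivAt (fun x => ?_) ((continuous_drift b p).mul
    ((continuous_sechPow b p).inv₀ fun x => (sechPow_pos b p x).ne'))
  have h := sechPow_pos b p x
  refine ((hasDerivAt_sechPow b p x).inv h.ne').congr_deriv ?_
  field_simp

theorem exp_neg_le_sechPow (hb : 0 < b) (hp : 0 < p) (x : ℝ) :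
    Real.exp (-(p * b * |x|)) ≤ sechPow b p x := by
  have h1 : Real.cosh (b * x) ≤ Real.exp (b * |x|) := by
    rw [← Real.cosh_abs, abs_mul, abs_of_pos hb, Real.cosh_eq]
    have : Real.exp (-(b * |x|)) ≤ Real.exp (b * |x|) :=
      Real.exp_le_exp.2 (by nlinarith [mul_nonneg hb.le (abs_nonneg x)])
    linarith
  have h2 : Real.exp (-(p * b * |x|)) = (1 / Real.exp (b * |x|)) ^ p := by
    rw [one_div, ← Real.exp_neg, ← Real.exp_mul]
    ring_nf
  rw [h2, sechPow]
  have := Real.cosh_pos (b * x)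
  gcongr

theorem sechPow_le_exp_neg (hb : 0 < b) (hp : 0 < p) (x : ℝ) :
    sechPow b p x ≤ 2 ^ p * Real.exp (-(p * b * |x|)) := by
  have h1 : Real.exp (b * |x|) / 2 ≤ Real.cosh (b * x) := by
    rw [← Real.cosh_abs, abs_mul, abs_of_pos hb, Real.cosh_eq]
    have := Real.exp_pos (-(b * |x|))
    linarith
  have h2 : 2 ^ p * Real.exp (-(p * b * |x|)) = (1 / (Real.exp (b * |x|) / 2)) ^ p := by
    rw [one_div_div, div_eq_mul_inv, Real.mul_rpow (by norm_num) (by positivity), ← Real.exp_neg,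
      ← Real.exp_mul]
    ring_nf
  rw [h2, sechPow]
  gcongr

theorem sechPow_ratio_le (hb : 0 < b) (hp : 0 < p) (x t : ℝ) :
    (sechPow b p x)⁻¹ * sechPow b p t ≤ 2 ^ p * Real.exp (-(p * b * (|t| - |x|))) := by
  have h1 := sechPow_le_exp_neg hb hp t
  have h2 := exp_neg_le_sechPow hb hp x
  rw [inv_mul_le_iff₀ (sechPow_pos b p x)]
  calc sechPow b p t ≤ 2 ^ p * Real.exp (-(p * b * |t|)) := h1
    _ = Real.exp (-(p * b * |x|)) * (2 ^ p * Real.exp (-(p * b * (|t| - |x|)))) := by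
        rw [show -(p * b * |t|) = -(p * b * |x|) + -(p * b * (|t| - |x|)) by ring, Real.exp_add]
        ring
    _ ≤ _ := by gcongr

theorem memLp_sechPow (hb : 0 < b) (hp : 0 < p) : MemLp (sechPow b p) 2 := by
  rw [memLp_two_iff_integrable_sq (continuous_sechPow b p).aestronglyMeasurable]
  have hi := (integrable_exp_neg_mul_abs (κ := 2 * (p * b)) (by positivity)).const_mul ((2 ^ p) ^ 2)
  refine hi.mono' ((continuous_sechPow b p).pow 2).aestronglyMeasurable
    (Eventually.of_forall fun x => ?_)
  rw [Real.norm_of_nonneg (sq_nonneg _)]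
  calc sechPow b p x ^ 2 ≤ (2 ^ p * Real.exp (-(p * b * |x|))) ^ 2 := by
        gcongr
        · exact (sechPow_pos b p x).le
        · exact sechPow_le_exp_neg hb hp x
    _ = _ := by
        rw [mul_pow, ← Real.exp_nat_mul]
        push_cast
        ring_nf

theorem _root_.MeasureTheory.MemLp.continuous_bdd_mul {f h : ℝ → ℝ} {C : ℝ} (hf : MemLp f 2)
    (hh : Continuous h) (hC : ∀ x, |h x| ≤ C) : MemLp (fun x => h x * f x) 2 := by
  refine hf.of_le_mul (c := C) (hh.aestronglyMeasurable.mul hf.1) (Eventually.of_forall fun x => ?_)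
  rw [norm_mul]
  gcongr
  exact hC x

theorem drift_bdd (b p x : ℝ) : |drift b p x| ≤ |p * b| := by
  rw [drift, abs_mul]
  exact mul_le_of_le_one_right (abs_nonneg _) (Real.abs_tanh_lt_one _).le

/-- The potential `m² - m'` of the Schrödinger operator factored by `m = drift b p`, equal to
`p² b² - p (p + 1) b² sech² (b x)`. -/
noncomputable def potential (b p x : ℝ) : ℝ :=
  drift b p x ^ 2 - p * b ^ 2 * (1 - Real.tanh (b * x) ^ 2)

theorem continuous_potential (b p : ℝ) : Continuous (potential b p) :=
  ((continuous_drift b p).pow 2).sub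
    (continuous_const.mul (continuous_const.sub ((continuous_tanh_mul b).pow 2)))

theorem potential_bdd (b p x : ℝ) : |potential b p x| ≤ |p * b| ^ 2 + |p * b ^ 2| := by
  refine (abs_sub _ _).trans (add_le_add ?_ ?_)
  · rw [abs_pow]
    exact pow_le_pow_left₀ (abs_nonneg _) (drift_bdd b p x) 2
  · rw [abs_mul]
    refine mul_le_of_le_one_right (abs_nonneg _) (abs_le.2 ⟨?_, ?_⟩)
    · linarith [Real.tanh_sq_lt_one (b * x)]
    · linarith [sq_nonneg (Real.tanh (b * x))]

theorem isH2_sechPow (hb : 0 < b) (hp : 0 < p) : IsH2 (sechPow b p)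
    (fun x => -(drift b p x * sechPow b p x)) (fun x => potential b p x * sechPow b p x) := by
  have hm := memLp_sechPow hb hp
  refine ⟨isPrim_sechPow b p, ?_, hm,
    (hm.continuous_bdd_mul (continuous_drift b p) (drift_bdd b p)).neg,
    hm.continuous_bdd_mul (continuous_potential b p) (potential_bdd b p)⟩
  have h := ((isPrim_drift b p).mul (isPrim_sechPow b p)).const_mul (-1)
  simp only [neg_one_mul] at h
  exact h.congr_fun fun x => by simp only [potential]; ring

end Sech

/-! ### Inversion of the factored Schrödinger operators -/

section Volterra

open Set

variable {b p : ℝ} {f y : ℝ → ℝ}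

theorem sechPow_kernel_le (hb : 0 < b) (hp : 0 < p) {x t s : ℝ} (h : |x| + s = |t|)
    (hs : s = |x - t|) :
    |(sechPow b p x)⁻¹ * sechPow b p t| ≤ 2 ^ p * Real.exp (-(p * b * |x - t|)) := by
  rw [abs_of_pos (mul_pos (inv_pos.2 (sechPow_pos b p x)) (sechPow_pos b p t))]
  have := sechPow_ratio_le hb hp x t
  rwa [show |t| - |x| = |x - t| by linarith] at this

/-- The first-order operator `-∂ + m` is inverted in `L²` on the orthogonal complement of
`g = sechᵖ (b x)`, by `y = g⁻¹ ∫ₓ^∞ g f`. It reverses parity. -/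
theorem exists_adjoint_solution (hb : 0 < b) (hp : 0 < p) (hf : MemLp f 2)
    (h0 : ∫ x, sechPow b p x * f x = 0) :
    ∃ y, IsPrim y (fun x => drift b p x * y x - f x) ∧ MemLp y 2 ∧
      ∀ σ : ℝ, (∀ᵐ x, f (-x) = σ * f x) → ∀ x, y (-x) = -(σ * y x) := by
  set g := sechPow b p with hg
  have hi : Integrable (fun x => g x * f x) := (memLp_sechPow hb hp).integrable_mul_two hf
  have hsplit : ∀ x, (∫ t in Iic x, g t * f t) = -∫ t in Ioi x, g t * f t := fun x => by
    have := intervalIntegral.integral_Iic_add_Ioi (b := x) hi.integrableOn hi.integrableOn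
    rw [h0] at this
    linarith
  have hJ : IsPrim (fun x => ∫ t in Ioi x, g t * f t) (fun x => -1 * (g x * f x)) := by
    have h1 : (fun x => ∫ t in Ioi x, g t * f t) =
        fun x => -1 * ((∫ t in Iic (0 : ℝ), g t * f t) + ∫ t in (0 : ℝ)..x, g t * f t) := by
      funext x
      rw [← intervalIntegral.integral_Iic_sub_Iic hi.integrableOn hi.integrableOn, hsplit x]
      ring
    rw [h1]
    exact (IsPrim.primitive hi.locallyIntegrable _).const_mul (-1)
  have hy : IsPrim (fun x => (g x)⁻¹ * ∫ t in Ioi x, g t * f t)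
      (fun x => drift b p x * ((g x)⁻¹ * ∫ t in Ioi x, g t * f t) - f x) := by
    refine ((isPrim_inv_sechPow b p).mul hJ).congr_fun fun x => ?_
    have := (sechPow_pos b p x).ne'
    simp only [← hg] at this ⊢
    field_simp
    ring
  refine ⟨_, hy, ?_, fun σ hσ x => ?_⟩
  · refine memLp_of_exp_kernel (C := 2 ^ p) (mul_pos hp hb) hy.continuous hf fun x => ?_
    rcases le_or_gt 0 x with hx | hx
    · refine ⟨Ioi x, fun t => (g x)⁻¹ * g t, measurableSet_Ioi, fun t ht => ?_, ?_⟩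
      · have ht' := mem_Ioi.1 ht
        refine sechPow_kernel_le hb hp (s := t - x) ?_ ?_
        · rw [abs_of_nonneg hx, abs_of_nonneg (hx.trans ht'.le)]; ring
        · rw [abs_of_neg (by linarith)]; ring
      · rw [← integral_const_mul]
        simp only [mul_assoc]
    · refine ⟨Iic x, fun t => (g x)⁻¹ * g t, measurableSet_Iic, fun t ht => ?_, ?_⟩
      · have ht' := mem_Iic.1 ht
        refine sechPow_kernel_le hb hp (s := x - t) ?_ ?_
        · rw [abs_of_neg hx, abs_of_neg (by linarith)]; ring
        · rw [abs_of_nonneg (by linarith)]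
      · simp only [mul_assoc]
        rw [integral_const_mul, hsplit, mul_neg, abs_neg]
  · have h1 : ∫ t in Ioi (-x), g t * f t = ∫ t in Iic x, g (-t) * f (-t) :=
      (integral_comp_neg_Iic x fun t => g t * f t).symm
    have h2 : ∫ t in Iic x, g (-t) * f (-t) = σ * ∫ t in Iic x, g t * f t := by
      rw [← integral_const_mul]
      refine setIntegral_congr_ae measurableSet_Iic (hσ.mono fun t ht _ => ?_)
      rw [ht, hg, sechPow_neg]
      ring
    rw [h1, h2, hsplit, hg, sechPow_neg]
    ring

/-- The first-order operator `∂ + m` is inverted in `L²` by `z = g ∫₀ˣ g⁻¹ y`, with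
`g = sechᵖ (b x)`. It reverses parity. -/
theorem exists_first_order_solution (hb : 0 < b) (hp : 0 < p) (hy : MemLp y 2) :
    ∃ z, IsPrim z (fun x => y x - drift b p x * z x) ∧ MemLp z 2 ∧
      ∀ σ : ℝ, (∀ᵐ x, y (-x) = σ * y x) → ∀ x, z (-x) = -(σ * z x) := by
  set g := sechPow b p with hg
  have hl : LocallyIntegrable (fun x => (g x)⁻¹ * y x) :=
    LocallyIntegrable.continuous_mul
      ((continuous_sechPow b p).inv₀ fun x => (sechPow_pos b p x).ne')
      (hy.locallyIntegrable (by norm_num))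
  have hz : IsPrim (fun x => g x * (0 + ∫ t in (0 : ℝ)..x, (g t)⁻¹ * y t))
      (fun x => y x - drift b p x * (g x * (0 + ∫ t in (0 : ℝ)..x, (g t)⁻¹ * y t))) := by
    refine ((isPrim_sechPow b p).mul (IsPrim.primitive hl 0)).congr_fun fun x => ?_
    have := (sechPow_pos b p x).ne'
    simp only [← hg] at this ⊢
    field_simp
    ring
  refine ⟨_, hz, ?_, fun σ hσ x => ?_⟩
  · refine memLp_of_exp_kernel (C := 2 ^ p) (mul_pos hp hb) hz.continuous hy fun x => ?_
    have hker : ∀ t, |t| + |x - t| = |x| →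
        |g x * (g t)⁻¹| ≤ 2 ^ p * Real.exp (-(p * b * |x - t|)) := fun t ht => by
      have := sechPow_kernel_le hb hp (x := t) (t := x) (s := |x - t|) ht (abs_sub_comm _ _)
      rwa [abs_sub_comm, mul_comm] at this
    rcases le_or_gt 0 x with hx | hx
    · refine ⟨Ioc 0 x, fun t => g x * (g t)⁻¹, measurableSet_Ioc, fun t ht => hker t ?_, ?_⟩
      · rw [abs_of_pos ht.1, abs_of_nonneg hx, abs_of_nonneg (by linarith [ht.2])]
        ring
      · rw [zero_add, intervalIntegral.integral_of_le hx, ← integral_const_mul]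
        simp only [mul_assoc]
    · refine ⟨Ioc x 0, fun t => g x * (g t)⁻¹, measurableSet_Ioc, fun t ht => hker t ?_, ?_⟩
      · rw [abs_of_nonpos ht.2, abs_of_neg hx, abs_of_neg (by linarith [ht.1])]
        ring
      · rw [zero_add, intervalIntegral.integral_of_ge hx.le, mul_neg, abs_neg,
          ← integral_const_mul]
        simp only [mul_assoc]
  · have h1 : ∫ t in (0 : ℝ)..(-x), (g t)⁻¹ * y t = -∫ t in (0 : ℝ)..x, (g (-t))⁻¹ * y (-t) := by
      rw [intervalIntegral.integral_comp_neg (fun t => (g t)⁻¹ * y t),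
        intervalIntegral.integral_symm, neg_zero]
    have h2 : ∫ t in (0 : ℝ)..x, (g (-t))⁻¹ * y (-t) =
        σ * ∫ t in (0 : ℝ)..x, (g t)⁻¹ * y t := by
      rw [← intervalIntegral.integral_const_mul]
      refine intervalIntegral.integral_congr_ae (hσ.mono fun t ht _ => ?_)
      rw [ht, hg, sechPow_neg]
      ring
    rw [h1, h2, hg, sechPow_neg]
    ring

/-- Inversion of `-∂² + (m² - m') = (-∂ + m) (∂ + m)` on the orthogonal complement of its
ground state `sechᵖ (b x)`. -/
theorem exists_factored_solution (hb : 0 < b) (hp : 0 < p) (hf : MemLp f 2)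
    (he : ∀ᵐ x, f (-x) = f x) (h0 : ∫ x, sechPow b p x * f x = 0) :
    ∃ z z₁, IsH2 z z₁ (fun x => potential b p x * z x - f x) ∧ ∀ x, z (-x) = z x := by
  obtain ⟨y, hy, hym, hyp⟩ := exists_adjoint_solution hb hp hf h0
  obtain ⟨z, hz, hzm, hzp⟩ := exists_first_order_solution hb hp hym
  refine ⟨z, _, ⟨hz, ?_, hzm, hym.sub
    (hzm.continuous_bdd_mul (continuous_drift b p) (drift_bdd b p)),
    (hzm.continuous_bdd_mul (continuous_potential b p) (potential_bdd b p)).sub hf⟩, fun x => ?_⟩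
  · exact (hy.sub ((isPrim_drift b p).mul hz)).congr_fun fun x => by simp only [potential]; ring
  · have := hzp (-1) (Eventually.of_forall fun t => by
      rw [hyp 1 (by simpa using he)]
      ring) x
    linarith

theorem integral_even_mul_odd {g f : ℝ → ℝ} (hg : ∀ x, g (-x) = g x) (hf : ∀ x, f (-x) = -f x) :
    ∫ x, g x * f x = 0 := by
  have h : ∫ x, g x * f x = -∫ x, g x * f x := by
    rw [← integral_neg, ← integral_neg_eq_self fun x => g x * f x]
    simp only [hg, hf, mul_neg]
  linarith

/-- Inversion of `L₁ = -∂² + 4 b² - 12 b² sech² (b x)` on the even functions. Writing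
`D_p = ∂ + drift b p`, there holds `L₁ D₃* = D₃* D₂* D₂`, so that on the orthogonal complement of
the ground state `sech³ (b x)`, which has eigenvalue `-5 b²`, the inverse is
`D₃* D₂⁻¹ (D₂*)⁻¹ (D₃*)⁻¹`; the odd function `(D₃*)⁻¹ f` is in the range of `D₂*` by parity. -/
theorem exists_solution_L₁ (hb : 0 < b) (hf : MemLp f 2) (he : ∀ᵐ x, f (-x) = f x) :
    ∃ w w₁, IsH2 w w₁ (fun x => (4 * b ^ 2 - 12 * b ^ 2 * (1 - Real.tanh (b * x) ^ 2)) * w x - f x) ∧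
      ∀ x, w (-x) = w x := by
  set g := sechPow b 3 with hg
  have hgm : MemLp g 2 := memLp_sechPow hb (by norm_num)
  have hgg := hgm.integrable_mul_two hgm
  have hgf := hgm.integrable_mul_two hf
  have hpos : 0 < ∫ x, g x * g x := by
    have hc : Continuous fun x => g x * g x :=
      (continuous_sechPow b 3).mul (continuous_sechPow b 3)
    refine (integral_pos_iff_support_of_nonneg (fun x => mul_self_nonneg (g x)) hgg).2 ?_
    have : Function.support (fun x => g x * g x) = univ := by
      ext x
      simpa using (sechPow_pos b 3 x).ne'
    rw [this]
    simp
  set a := (∫ x, g x * f x) / ∫ x, g x * g x with ha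
  have hf' : MemLp (fun x => f x - a * g x) 2 := hf.sub (hgm.const_mul a)
  have he' : ∀ᵐ x, f (-x) - a * g (-x) = 1 * (f x - a * g x) := by
    filter_upwards [he] with x hx
    rw [hx, hg, sechPow_neg, one_mul]
  have h0 : ∫ x, g x * (f x - a * g x) = 0 := by
    have h1 : ∀ x, g x * (f x - a * g x) = g x * f x - a * (g x * g x) := fun x => by ring
    simp only [h1]
    rw [integral_sub hgf (hgg.const_mul a), integral_const_mul, ha, div_mul_cancel₀ _ hpos.ne',
      sub_self]
  obtain ⟨y, hy, hym, hyp⟩ := exists_adjoint_solution hb (by norm_num) hf' h0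
  have hyo : ∀ x, y (-x) = -y x := fun x => by rw [hyp 1 he' x, one_mul]
  obtain ⟨u, hu, hum, hup⟩ := exists_adjoint_solution hb (p := 2) (by norm_num) hym
    (integral_even_mul_odd (sechPow_neg b 2) hyo)
  have hue : ∀ x, u (-x) = u x := fun x => by
    rw [hup (-1) (Eventually.of_forall fun x => by rw [hyo]; ring) x]; ring
  obtain ⟨v, hv, hvm, hvp⟩ := exists_first_order_solution hb (p := 2) (by norm_num) hum
  have hvo : ∀ x, v (-x) = -v x := fun x => by
    rw [hvp 1 (Eventually.of_forall fun x => by rw [hue, one_mul]) x, one_mul]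
  have hT := isPrim_tanh b
  have hTc := continuous_tanh_mul b
  have hTb : ∀ x, |Real.tanh (b * x)| ≤ 1 := fun x => (Real.abs_tanh_lt_one _).le
  have hT2 : ∀ x, Real.tanh (b * x) ^ 2 ≤ 1 := fun x => (Real.tanh_sq_lt_one _).le
  -- `w = D₃* v` and its derivative
  have hw : IsPrim (fun x => 5 * b * (Real.tanh (b * x) * v x) - u x)
      (fun x => 5 * b ^ 2 * ((1 - 3 * (Real.tanh (b * x) * Real.tanh (b * x))) * v x)
        + 3 * b * (Real.tanh (b * x) * u x) + y x) := by
    refine (((hT.mul hv).const_mul (5 * b)).sub hu).congr_fun fun x => ?_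
    simp only [drift]
    ring
  have hw₁ : IsPrim (fun x => 5 * b ^ 2 * ((1 - 3 * (Real.tanh (b * x) * Real.tanh (b * x))) * v x)
        + 3 * b * (Real.tanh (b * x) * u x) + y x)
      (fun x => (4 * b ^ 2 - 12 * b ^ 2 * (1 - Real.tanh (b * x) ^ 2))
        * (5 * b * (Real.tanh (b * x) * v x) - u x) - (f x - a * g x)) := by
    have h1 : IsPrim (fun _ : ℝ => (1 : ℝ)) (fun _ => 0) :=
      .of_hasDerivAt (fun x => hasDerivAt_const x 1) continuous_const
    refine (((((h1.sub ((hT.mul hT).const_mul 3)).mul hv).const_mul (5 * b ^ 2)).add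
      ((hT.mul hu).const_mul (3 * b))).add hy).congr_fun fun x => ?_
    simp only [drift]
    ring
  have hwm : MemLp (fun x => 5 * b * (Real.tanh (b * x) * v x) - u x) 2 :=
    ((hvm.continuous_bdd_mul hTc hTb).const_mul _).sub hum
  have hVc : Continuous fun x => 4 * b ^ 2 - 12 * b ^ 2 * (1 - Real.tanh (b * x) ^ 2) := by
    fun_prop
  have hVb : ∀ x, |4 * b ^ 2 - 12 * b ^ 2 * (1 - Real.tanh (b * x) ^ 2)| ≤ 12 * b ^ 2 := fun x => by
    have h1 := hT2 x
    have h2 := sq_nonneg (Real.tanh (b * x))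
    have h3 := sq_nonneg b
    rw [abs_le]
    constructor <;> nlinarith
  have hH : IsH2 _ _ _ := ⟨hw, hw₁, hwm,
    ((((hvm.continuous_bdd_mul (C := 4) (by fun_prop) fun x => by
      have h1 := hT2 x
      have h2 := sq_nonneg (Real.tanh (b * x))
      rw [abs_le]
      constructor <;> nlinarith).const_mul _).add
        ((hum.continuous_bdd_mul hTc hTb).const_mul _)).add hym),
    (hwm.continuous_bdd_mul hVc hVb).sub hf'⟩
  have hG := (isH2_sechPow hb (p := 3) (by norm_num)).const_mul (-a / (5 * b ^ 2))
  have hsum := hH.add hG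
  refine ⟨_, _, ⟨hsum.prim, hsum.prim₁.congr_fun fun x => ?_, hsum.memLp, hsum.memLp₁,
    (hsum.memLp.continuous_bdd_mul hVc hVb).sub hf⟩, fun x => ?_⟩
  · simp only [potential, drift, ← hg]
    field_simp
    ring
  · simp only [mul_neg, Real.tanh_neg, hvo, hue, sechPow_neg]
    ring

end Volterra

/-! ### The Hilbert space of even functions -/

section EvenSpace

open Set

/-- The reflection `f ↦ f ∘ (-·)` on `L²(ℝ)`. -/
noncomputable def reflection :
    Lp ℝ 2 (volume : Measure ℝ) →L[ℝ] Lp ℝ 2 (volume : Measure ℝ) :=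
  (Lp.compMeasurePreservingₗᵢ ℝ (Neg.neg : ℝ → ℝ)
    (Measure.measurePreserving_neg volume)).toContinuousLinearMap

theorem reflection_ae (u : Lp ℝ 2 (volume : Measure ℝ)) : ∀ᵐ x, reflection u x = u (-x) :=
  Lp.coeFn_compMeasurePreserving u (Measure.measurePreserving_neg volume)

/-- The closed subspace of even functions in `L²(ℝ)`. -/
noncomputable def evenSubspace : Submodule ℝ (Lp ℝ 2 (volume : Measure ℝ)) :=
  (reflection - ContinuousLinearMap.id ℝ (Lp ℝ 2 (volume : Measure ℝ))).ker

/-- The Hilbert space of even functions in `L²(ℝ)`. -/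
def EvenL2 : Type := evenSubspace

noncomputable instance : NormedAddCommGroup EvenL2 :=
  inferInstanceAs (NormedAddCommGroup evenSubspace)

noncomputable instance : InnerProductSpace ℝ EvenL2 :=
  inferInstanceAs (InnerProductSpace ℝ evenSubspace)

instance : CompleteSpace EvenL2 :=
  inferInstanceAs (CompleteSpace
    (reflection - ContinuousLinearMap.id ℝ (Lp ℝ 2 (volume : Measure ℝ))).ker)

namespace EvenL2

/-- A representative of an element of `EvenL2`. -/
noncomputable def fn (u : EvenL2) : ℝ → ℝ := u.1

theorem memLp_fn (u : EvenL2) : MemLp u.fn 2 := Lp.memLp _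

theorem ext_ae {u v : EvenL2} (h : u.fn =ᵐ[volume] v.fn) : u = v := Subtype.ext (Lp.ext h)

theorem fn_even (u : EvenL2) : ∀ᵐ x, u.fn (-x) = u.fn x := by
  have h := LinearMap.mem_ker.1 u.2
  have h' : reflection u.1 = u.1 := by
    simpa [sub_eq_zero] using h
  have h2 := reflection_ae u.1
  rw [h'] at h2
  filter_upwards [h2] with x hx
  exact hx.symm

/-- The class of an even square-integrable function. -/
noncomputable def mk (f : ℝ → ℝ) (hf : MemLp f 2) (he : ∀ᵐ x, f (-x) = f x) : EvenL2 :=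
  ⟨hf.toLp f, by
    refine LinearMap.mem_ker.2 ?_
    have h : reflection (hf.toLp f) = hf.toLp f := by
      refine Lp.ext ?_
      have h1 := (Measure.measurePreserving_neg (volume : Measure ℝ)).quasiMeasurePreserving.ae
        hf.coeFn_toLp
      filter_upwards [reflection_ae (hf.toLp f), hf.coeFn_toLp, h1, he] with x h2 h3 h4 h5
      rw [h2, h3, h4, h5]
    simp [h]⟩

theorem fn_mk {f : ℝ → ℝ} (hf : MemLp f 2) (he : ∀ᵐ x, f (-x) = f x) :
    (mk f hf he).fn =ᵐ[volume] f := hf.coeFn_toLp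

theorem fn_add (u v : EvenL2) : (u + v).fn =ᵐ[volume] fun x => u.fn x + v.fn x :=
  Lp.coeFn_add _ _

theorem fn_smul (a : ℝ) (u : EvenL2) : (a • u).fn =ᵐ[volume] fun x => a * u.fn x :=
  Lp.coeFn_smul _ _

theorem fn_neg (u : EvenL2) : (-u).fn =ᵐ[volume] fun x => -u.fn x :=
  Lp.coeFn_neg _

theorem fn_zero : (0 : EvenL2).fn =ᵐ[volume] fun _ => 0 :=
  Lp.coeFn_zero ℝ 2 volume

theorem inner_eq (u v : EvenL2) : inner ℝ u v = innerL2 u.fn v.fn := by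
  refine (L2.inner_def u.1 v.1).trans ?_
  refine integral_congr_ae (Eventually.of_forall fun x => ?_)
  simp [fn, mul_comm]

theorem innerL2_self (u : EvenL2) : innerL2 u.fn u.fn = ‖u‖ ^ 2 := by
  rw [← inner_eq, real_inner_self_eq_norm_sq]

theorem normL2_fn (u : EvenL2) : normL2 u.fn = ‖u‖ := by
  rw [normL2, innerL2_self, Real.sqrt_sq (norm_nonneg u)]

theorem norm_le_of_ae {u v : EvenL2} {C : ℝ} (h : ∀ᵐ x, |u.fn x| ≤ C * |v.fn x|) :
    ‖u‖ ≤ C * ‖v‖ :=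
  Lp.norm_le_mul_norm_of_ae_le_mul (f := u.1) (g := v.1) h

theorem memLp_mul_of_bdd {f : ℝ → ℝ} {C : ℝ} (hf : AEStronglyMeasurable f volume)
    (hC : ∀ᵐ x, |f x| ≤ C) (v : EvenL2) : MemLp (fun x => f x * v.fn x) 2 := by
  refine v.memLp_fn.of_le_mul (c := C) (hf.mul v.memLp_fn.1) ?_
  filter_upwards [hC] with x hx
  rw [norm_mul]
  gcongr
  exact hx

/-- The product `(u, v) ↦ (S u) v` for an operator `S` from `L²` to `L^∞`. -/
theorem exists_product (S : EvenL2 →L[ℝ] EvenL2) {M : ℝ}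
    (hS : ∀ u, ∀ᵐ x, |(S u).fn x| ≤ M * ‖u‖) :
    ∃ B : EvenL2 →L[ℝ] EvenL2 →L[ℝ] EvenL2,
      ∀ u v, (B u v).fn =ᵐ[volume] fun x => (S u).fn x * v.fn x := by
  let m : EvenL2 → EvenL2 → EvenL2 := fun u v => mk (fun x => (S u).fn x * v.fn x)
    (memLp_mul_of_bdd (S u).memLp_fn.1 (hS u) v) (by
      filter_upwards [(S u).fn_even, v.fn_even] with x h1 h2
      rw [h1, h2])
  have hm : ∀ u v, (m u v).fn =ᵐ[volume] fun x => (S u).fn x * v.fn x := fun u v => fn_mk _ _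
  refine ⟨LinearMap.mkContinuous₂ (LinearMap.mk₂ ℝ m ?_ ?_ ?_ ?_) M ?_, fun u v => hm u v⟩
  · intro u u' v
    refine ext_ae ?_
    have h0 := fn_add (S u) (S u')
    rw [← map_add] at h0
    filter_upwards [hm (u + u') v, fn_add (m u v) (m u' v), hm u v, hm u' v, h0]
      with x h1 h2 h3 h4 h5
    rw [h1, h2, h3, h4, h5]
    ring
  · intro a u v
    refine ext_ae ?_
    have h0 := fn_smul a (S u)
    rw [← map_smul] at h0
    filter_upwards [hm (a • u) v, fn_smul a (m u v), hm u v, h0] with x h1 h2 h3 h5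
    rw [h1, h2, h3, h5]
    ring
  · intro u v v'
    refine ext_ae ?_
    filter_upwards [hm u (v + v'), fn_add (m u v) (m u v'), hm u v, hm u v', fn_add v v']
      with x h1 h2 h3 h4 h5
    rw [h1, h2, h3, h4, h5]
    ring
  · intro a u v
    refine ext_ae ?_
    filter_upwards [hm u (a • v), fn_smul a (m u v), hm u v, fn_smul a v] with x h1 h2 h3 h5
    rw [h1, h2, h3, h5]
    ring
  · intro u v
    rw [LinearMap.mk₂_apply]
    refine norm_le_of_ae ?_
    filter_upwards [hm u v, hS u] with x h1 h2
    rw [h1, abs_mul]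
    gcongr

end EvenL2

end EvenSpace

/-! ### Inverses of symmetric relations -/

section Inverse

variable {H : Type*} [NormedAddCommGroup H] [InnerProductSpace ℝ H] [CompleteSpace H]

/-- A symmetric linear relation whose domain is everything is the graph of a bounded operator:
symmetry and surjectivity give uniqueness, and Hellinger–Toeplitz gives continuity. -/
theorem exists_clm_of_symmetric_relation {T : H → H → Prop}
    (hadd : ∀ {u s u' s'}, T u s → T u' s' → T (u + u') (s + s'))
    (hsmul : ∀ {u s} (a : ℝ), T u s → T (a • u) (a • s))
    (hsymm : ∀ {u s u' s'}, T u s → T u' s' → inner ℝ s u' = inner ℝ u s')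
    (htot : ∀ u, ∃ s, T u s) :
    ∃ S : H →L[ℝ] H, ∀ u s, T u s ↔ s = S u := by
  have huniq : ∀ {u s s'}, T u s → T u s' → s = s' := by
    intro u s s' h h'
    have hd : T 0 (s - s') := by
      have := hadd h (hsmul (-1) h')
      simpa [sub_eq_add_neg] using this
    obtain ⟨t, ht⟩ := htot (s - s')
    have h0 := hsymm hd ht
    rw [inner_zero_left, inner_self_eq_zero] at h0
    exact sub_eq_zero.1 h0
  choose S hS using htot
  let L : H →ₗ[ℝ] H :=
    { toFun := S
      map_add' := fun u u' => huniq (hS _) (hadd (hS u) (hS u'))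
      map_smul' := fun a u => huniq (hS _) (hsmul a (hS u)) }
  have hL : L.IsSymmetric := fun u v => hsymm (hS u) (hS v)
  exact ⟨⟨L, hL.continuous⟩, fun u s => ⟨fun h => huniq h (hS u), fun h => h ▸ hS u⟩⟩

end Inverse

/-! ### Schrödinger equations in the even space -/

section Schrodinger

open EvenL2

/-- The relation `-s'' + V s = u` between even `L²` functions, with `s` in `H²`. -/
def Solves (V : ℝ → ℝ) (u s : EvenL2) : Prop :=
  ∃ w w₁, IsH2 w w₁ (fun x => V x * w x - u.fn x) ∧ s.fn =ᵐ[volume] w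

theorem IsH2.congr {f f₁ f₂ f₂' : ℝ → ℝ} (hf : IsH2 f f₁ f₂) (h : f₂ =ᵐ[volume] f₂') :
    IsH2 f f₁ f₂' :=
  ⟨hf.prim, hf.prim₁.congr h, hf.memLp, hf.memLp₁, hf.memLp₂.ae_eq h⟩

namespace Solves

variable {V : ℝ → ℝ} {u s u' s' : EvenL2}

theorem add (h : Solves V u s) (h' : Solves V u' s') : Solves V (u + u') (s + s') := by
  obtain ⟨w, w₁, hw, he⟩ := h
  obtain ⟨w', w₁', hw', he'⟩ := h'
  refine ⟨_, _, (hw.add hw').congr ?_, ?_⟩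
  · filter_upwards [fn_add u u'] with x hx
    rw [hx]
    ring
  · filter_upwards [fn_add s s', he, he'] with x h1 h2 h3
    rw [h1, h2, h3]

theorem smul (a : ℝ) (h : Solves V u s) : Solves V (a • u) (a • s) := by
  obtain ⟨w, w₁, hw, he⟩ := h
  refine ⟨_, _, (hw.const_mul a).congr ?_, ?_⟩
  · filter_upwards [fn_smul a u] with x hx
    rw [hx]
    ring
  · filter_upwards [fn_smul a s, he] with x h1 h2
    rw [h1, h2]

theorem symm (hVc : Continuous V) {K : ℝ} (hV : ∀ x, |V x| ≤ K) (h : Solves V u s)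
    (h' : Solves V u' s') : inner ℝ s u' = inner ℝ u s' := by
  obtain ⟨w, w₁, hw, he⟩ := h
  obtain ⟨w', w₁', hw', he'⟩ := h'
  rw [inner_eq, inner_eq, innerL2_congr he .rfl, innerL2_congr .rfl he']
  have h0 := hw.innerL2_symm hw'
  have i0 := (hw.memLp.continuous_bdd_mul hVc hV).integrable_mul_two hw'.memLp
  have i1 := u.memLp_fn.integrable_mul_two hw'.memLp
  have i2 := hw.memLp.integrable_mul_two u'.memLp_fn
  have e1 : innerL2 (fun x => V x * w x - u.fn x) w' =
      (∫ x, V x * w x * w' x) - innerL2 u.fn w' := by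
    rw [innerL2, innerL2, ← integral_sub i0 i1]
    exact integral_congr_ae (Eventually.of_forall fun x => by ring)
  have e2 : innerL2 w (fun x => V x * w' x - u'.fn x) =
      (∫ x, V x * w x * w' x) - innerL2 w u'.fn := by
    rw [innerL2, innerL2, ← integral_sub i0 i2]
    exact integral_congr_ae (Eventually.of_forall fun x => by ring)
  rw [e1, e2] at h0
  linarith

/-- Elliptic regularity: the `H²` and `L^∞` norms of `s` are controlled by `‖u‖ + ‖s‖`. -/
theorem bounds {K : ℝ} (hV : ∀ x, |V x| ≤ K) (h : Solves V u s) :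
    (∀ᵐ x, |s.fn x| ≤ (2 + 2 * K) * (‖u‖ + ‖s‖)) ∧
      normH2 s.fn ≤ (2 + 2 * K) * (‖u‖ + ‖s‖) := by
  obtain ⟨w, w₁, hw, he⟩ := h
  have hK : 0 ≤ K := (abs_nonneg _).trans (hV 0)
  have e0 : innerL2 w w = ‖s‖ ^ 2 := by rw [← innerL2_self, innerL2_congr he he]
  have e1 := hw.energy_le
  have e2 : innerL2 (fun x => V x * w x - u.fn x) (fun x => V x * w x - u.fn x) ≤
      2 * K ^ 2 * ‖s‖ ^ 2 + 2 * ‖u‖ ^ 2 := by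
    have i0 := (hw.memLp.integrable_mul_two hw.memLp).const_mul (2 * K ^ 2)
    have i1 := (u.memLp_fn.integrable_mul_two u.memLp_fn).const_mul 2
    rw [← e0, ← innerL2_self u, innerL2, innerL2, innerL2, ← integral_const_mul,
      ← integral_const_mul, ← integral_add i0 i1]
    refine integral_mono (hw.memLp₂.integrable_mul_two hw.memLp₂) (i0.add i1) fun x => ?_
    have h1 : (V x * w x) ^ 2 ≤ K ^ 2 * (w x * w x) := by
      rw [mul_pow, ← sq (w x)]
      have : V x ^ 2 ≤ K ^ 2 := sq_le_sq' (abs_le.1 (hV x)).1 (abs_le.1 (hV x)).2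
      gcongr
    beta_reduce
    nlinarith [sq_nonneg (V x * w x + u.fn x)]
  have hu := norm_nonneg u
  have hs := norm_nonneg s
  have hp : 0 ≤ ‖u‖ * ‖s‖ := by positivity
  have hC : (0 : ℝ) ≤ (2 + 2 * K) * (‖u‖ + ‖s‖) := by positivity
  have hexp : ((2 + 2 * K) * (‖u‖ + ‖s‖)) ^ 2 = 4 * ‖u‖ ^ 2 + 4 * ‖s‖ ^ 2 + 4 * K ^ 2 * ‖s‖ ^ 2
      + (4 * (K * (K + 2)) * ‖u‖ ^ 2 + 8 * K * ‖s‖ ^ 2 + 8 * (1 + K) ^ 2 * (‖u‖ * ‖s‖)) := by ring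
  have hrest : 0 ≤ 4 * (K * (K + 2)) * ‖u‖ ^ 2 + 8 * K * ‖s‖ ^ 2
      + 8 * (1 + K) ^ 2 * (‖u‖ * ‖s‖) := by positivity
  have hKs : 0 ≤ K ^ 2 * ‖s‖ ^ 2 := by positivity
  refine ⟨?_, ?_⟩
  · filter_upwards [he] with x hx
    rw [hx]
    refine abs_le_of_sq_le_sq ?_ hC
    have := hw.sq_le x
    nlinarith
  · rw [hw.normH2_eq he]
    refine Real.sqrt_le_iff.2 ⟨hC, ?_⟩
    nlinarith

theorem memH2Even (h : Solves V u s) : MemH2Even s.fn := by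
  obtain ⟨w, w₁, hw, he⟩ := h
  exact ⟨hw.memH2 he, s.fn_even⟩

theorem weakDeriv₂_ae_eq (h : Solves V u s) :
    ∀ᵐ x, weakDeriv₂ s.fn x = V x * s.fn x - u.fn x := by
  obtain ⟨w, w₁, hw, he⟩ := h
  filter_upwards [hw.weakDeriv₂_ae_eq he, he] with x h1 h2
  rw [h1, h2]

theorem of_memH2Even {W : ℝ → ℝ} (hW : MemH2Even W) (hs : s.fn =ᵐ[volume] W)
    (h : ∀ᵐ x, -weakDeriv₂ W x + V x * W x = u.fn x) : Solves V u s := by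
  obtain ⟨w, w₁, w₂, hw, he⟩ := hW.1.exists_isH2
  refine ⟨w, w₁, hw.congr ?_, hs.trans he⟩
  filter_upwards [h, hw.weakDeriv₂_ae_eq he, he] with x h1 h2 h3
  rw [← h1, h2, h3]
  ring

/-- The operator `-∂² + V` is bounded from `H²` to `L²`. -/
theorem norm_le_normH2 {K : ℝ} (hV : ∀ x, |V x| ≤ K) (h : Solves V u s) :
    ‖u‖ ≤ (2 * K + 2) * normH2 s.fn := by
  obtain ⟨w, w₁, hw, he⟩ := h
  have hK : 0 ≤ K := (abs_nonneg _).trans (hV 0)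
  set w₂ : ℝ → ℝ := fun x => V x * w x - u.fn x with hw₂
  have i0 := (hw.memLp.integrable_mul_two hw.memLp).const_mul (2 * K ^ 2)
  have i1 := (hw.memLp₂.integrable_mul_two hw.memLp₂).const_mul 2
  have h1 : ‖u‖ ^ 2 ≤ 2 * K ^ 2 * innerL2 w w + 2 * innerL2 w₂ w₂ := by
    rw [← innerL2_self u, innerL2, innerL2, innerL2, ← integral_const_mul,
      ← integral_const_mul, ← integral_add i0 i1]
    refine integral_mono (u.memLp_fn.integrable_mul_two u.memLp_fn) (i0.add i1) fun x => ?_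
    have h1 : (V x * w x) ^ 2 ≤ K ^ 2 * (w x * w x) := by
      rw [mul_pow, ← sq (w x)]
      have : V x ^ 2 ≤ K ^ 2 := sq_le_sq' (abs_le.1 (hV x)).1 (abs_le.1 (hV x)).2
      gcongr
    simp only [hw₂]
    nlinarith [sq_nonneg (2 * (V x * w x) - u.fn x)]
  have h0 := innerL2_self_nonneg w
  have h0₁ := innerL2_self_nonneg w₁
  have h0₂ := innerL2_self_nonneg w₂
  have hn : normH2 s.fn ^ 2 = innerL2 w w + innerL2 w₁ w₁ + innerL2 w₂ w₂ := by
    rw [hw.normH2_eq he, Real.sq_sqrt (by positivity)]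
  have hn0 : 0 ≤ normH2 s.fn := Real.sqrt_nonneg _
  refine le_of_sq_le_sq ?_ (by positivity)
  rw [mul_pow, hn]
  have e1 : 0 ≤ K ^ 2 * innerL2 w w := by positivity
  have e2 : 0 ≤ K * innerL2 w w := by positivity
  have e3 : 0 ≤ (2 * K + 2) ^ 2 * innerL2 w₁ w₁ := by positivity
  have e4 : 0 ≤ K ^ 2 * innerL2 w₂ w₂ := by positivity
  have e5 : 0 ≤ K * innerL2 w₂ w₂ := by positivity
  nlinarith

end Solves

end Schrodinger

/-! ### The potentials at the soliton -/

section Soliton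

variable {c k : ℝ}

theorem half_sqrt_pos (hc : 0 < c) : 0 < √c / 2 := by positivity

theorem half_sqrt_sq (hc : 0 < c) : (√c / 2) ^ 2 = c / 4 := by
  rw [div_pow, Real.sq_sqrt hc.le]
  norm_num

theorem soliton_eq (c x : ℝ) : soliton c x = 3 * c * (1 - Real.tanh (√c / 2 * x) ^ 2) := by
  rw [soliton, sech_sq]

theorem expo_pos (hk : 0 < k) : 0 < expo k := by
  have : 1 < √(1 + 48 * k) := Real.lt_sqrt_of_sq_lt (by linarith)
  rw [expo]
  linarith

theorem expo_mul_add_one (hk : 0 < k) : expo k * (expo k + 1) = 12 * k := by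
  have := Real.sq_sqrt (show 0 ≤ 1 + 48 * k by linarith)
  rw [expo]
  linarith

/-- The potential `c - U₀` of `L₁`. -/
noncomputable def potential₁ (c x : ℝ) : ℝ := c - soliton c x

/-- The potential `-Ω_c - k U₀` of `L₂`. -/
noncomputable def potential₂ (c k x : ℝ) : ℝ := -(Omegac c k + k * soliton c x)

theorem potential₁_eq (hc : 0 < c) (x : ℝ) : potential₁ c x =
    4 * (√c / 2) ^ 2 - 12 * (√c / 2) ^ 2 * (1 - Real.tanh (√c / 2 * x) ^ 2) := by
  rw [potential₁, soliton_eq, half_sqrt_sq hc]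
  ring

theorem potential₂_eq (hc : 0 < c) (hk : 0 < k) (x : ℝ) :
    potential₂ c k x = potential (√c / 2) (expo k) x := by
  have h1 : Omegac c k = -(c / 4) * expo k ^ 2 := by rw [Omegac, expo]; ring
  rw [potential₂, soliton_eq, potential, drift, mul_pow, mul_pow, half_sqrt_sq hc, h1]
  linear_combination c / 4 * (1 - Real.tanh (√c / 2 * x) ^ 2) * expo_mul_add_one hk

theorem continuous_soliton (c : ℝ) : Continuous (soliton c) := by
  have := continuous_tanh_mul (√c / 2)
  rw [show soliton c = _ from funext (soliton_eq c)]
  fun_prop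

theorem soliton_nonneg (hc : 0 < c) (x : ℝ) : 0 ≤ soliton c x := by
  rw [soliton]
  positivity

theorem soliton_le (hc : 0 < c) (x : ℝ) : soliton c x ≤ 3 * c := by
  rw [soliton_eq]
  nlinarith [sq_nonneg (Real.tanh (√c / 2 * x))]

theorem potential₁_bdd (hc : 0 < c) (x : ℝ) : |potential₁ c x| ≤ 3 * c := by
  have h1 := soliton_nonneg hc x
  have h2 := soliton_le hc x
  rw [potential₁, abs_le]
  constructor <;> linarith

theorem continuous_potential₁ (c : ℝ) : Continuous (potential₁ c) :=
  continuous_const.sub (continuous_soliton c)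

theorem continuous_potential₂ (c k : ℝ) : Continuous (potential₂ c k) :=
  (continuous_const.add (continuous_const.mul (continuous_soliton c))).neg

theorem potential₂_bdd (hc : 0 < c) (hk : 0 < k) (x : ℝ) :
    |potential₂ c k x| ≤ |Omegac c k| + k * (3 * c) := by
  rw [potential₂, abs_neg]
  refine (abs_add_le _ _).trans (add_le_add le_rfl ?_)
  rw [abs_mul, abs_of_pos hk, abs_of_nonneg (soliton_nonneg hc x)]
  gcongr
  exact soliton_le hc x

/-- The soliton solves `U'' = c U - U² / 2`. -/
theorem exists_isH2_soliton (hc : 0 < c) : ∃ U₁,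
    IsH2 (soliton c) U₁ (fun x => c * soliton c x - 1 / 2 * soliton c x ^ 2) := by
  have h := (isH2_sechPow (half_sqrt_pos hc) (p := 2) (by norm_num)).const_mul (3 * c)
  have h1 : (fun x => 3 * c * sechPow (√c / 2) 2 x) = soliton c := by
    funext x
    rw [sechPow, soliton, Real.rpow_two]
  rw [h1] at h
  refine ⟨_, h.congr (Eventually.of_forall fun x => ?_)⟩
  beta_reduce
  rw [show 3 * c * (potential (√c / 2) 2 x * sechPow (√c / 2) 2 x) =
    potential (√c / 2) 2 x * soliton c x by rw [← h1]; ring, potential, drift, mul_pow, mul_pow,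
    half_sqrt_sq hc, soliton_eq]
  ring

theorem soliton_neg (c x : ℝ) : soliton c (-x) = soliton c x := by
  rw [soliton, soliton, mul_neg, Real.cosh_neg]

theorem memH2Even_soliton (hc : 0 < c) : MemH2Even (soliton c) := by
  obtain ⟨U₁, h⟩ := exists_isH2_soliton hc
  exact ⟨h.memH2 .rfl, Eventually.of_forall (soliton_neg c)⟩

end Soliton

/-! ### The inverse operators -/

section Operators

open EvenL2

variable {c k : ℝ}

/-- The inverse of `-∂² + V + P`, as a bounded operator into `L^∞` and `H²`. -/
theorem exists_inverse_operator {V : ℝ → ℝ} (hVc : Continuous V) {K : ℝ} (hV : ∀ x, |V x| ≤ K)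
    (P : EvenL2 →L[ℝ] EvenL2) (hP : ∀ u v, inner ℝ (P u) v = inner ℝ u (P v))
    (htot : ∀ u, ∃ s, Solves V (u - P s) s) :
    ∃ (S : EvenL2 →L[ℝ] EvenL2) (M : ℝ), 0 < M ∧
      (∀ u s, Solves V (u - P s) s ↔ s = S u) ∧
      ∀ u, (∀ᵐ x, |(S u).fn x| ≤ M * ‖u‖) ∧ normH2 (S u).fn ≤ M * ‖u‖ := by
  obtain ⟨S, hS⟩ := exists_clm_of_symmetric_relation (T := fun u s => Solves V (u - P s) s)
    (fun {u s u' s'} h h' => by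
      have h2 := h.add h'
      rwa [show u - P s + (u' - P s') = u + u' - P (s + s') by rw [map_add]; abel] at h2)
    (fun {u s} a h => by
      have h2 := h.smul a
      rwa [smul_sub, ← map_smul] at h2)
    (fun {u s u' s'} h h' => by
      have h2 := h.symm hVc hV h'
      rw [inner_sub_right, inner_sub_left, hP] at h2
      linarith)
    htot
  have hK : 0 ≤ K := (abs_nonneg _).trans (hV 0)
  refine ⟨S, (2 + 2 * K) * (1 + ‖P‖ * ‖S‖ + ‖S‖), by positivity, hS, fun u => ?_⟩
  have hb := ((hS u (S u)).2 rfl).bounds hV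
  have hle : (2 + 2 * K) * (‖u - P (S u)‖ + ‖S u‖) ≤
      (2 + 2 * K) * (1 + ‖P‖ * ‖S‖ + ‖S‖) * ‖u‖ := by
    rw [mul_assoc]
    gcongr
    have h1 : ‖S u‖ ≤ ‖S‖ * ‖u‖ := S.le_opNorm u
    have h2 : ‖P (S u)‖ ≤ ‖P‖ * (‖S‖ * ‖u‖) := (P.le_opNorm _).trans (by gcongr)
    have h3 := norm_sub_le u (P (S u))
    linarith
  exact ⟨hb.1.mono fun x hx => hx.trans hle, hb.2.trans hle⟩

theorem exists_solves₁ (hc : 0 < c) (u : EvenL2) : ∃ s, Solves (potential₁ c) u s := by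
  obtain ⟨w, w₁, hw, he⟩ := exists_solution_L₁ (half_sqrt_pos hc) u.memLp_fn u.fn_even
  refine ⟨EvenL2.mk w hw.memLp (Eventually.of_forall he), w, w₁, ?_, fn_mk _ _⟩
  simpa only [potential₁_eq hc] using hw

theorem memLp_eigenfun (hc : 0 < c) (hk : 0 < k) : MemLp (eigenfun c k) 2 :=
  memLp_sechPow (half_sqrt_pos hc) (expo_pos hk)

theorem eigenfun_neg (c k x : ℝ) : eigenfun c k (-x) = eigenfun c k x := sechPow_neg _ _ x

/-- The eigenfunction as an element of the even `L²` space. -/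
noncomputable def eigenvec (hc : 0 < c) (hk : 0 < k) : EvenL2 :=
  EvenL2.mk (eigenfun c k) (memLp_eigenfun hc hk) (Eventually.of_forall (eigenfun_neg c k))

theorem eigenvec_ae (hc : 0 < c) (hk : 0 < k) : (eigenvec hc hk).fn =ᵐ[volume] eigenfun c k :=
  fn_mk _ _

theorem eigenvec_ne_zero (hc : 0 < c) (hk : 0 < k) : eigenvec hc hk ≠ 0 := by
  intro h
  have h1 := eigenvec_ae hc hk
  rw [h] at h1
  have h2 : ∀ᵐ _ : ℝ, False := by
    filter_upwards [h1, fn_zero] with x h3 h4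
    rw [h3] at h4
    exact (sechPow_pos _ _ x).ne' h4
  exact h2.exists.elim fun _ h => h

theorem solves_eigenvec (hc : 0 < c) (hk : 0 < k) :
    Solves (potential₂ c k) 0 (eigenvec hc hk) := by
  refine ⟨_, _, (isH2_sechPow (half_sqrt_pos hc) (expo_pos hk)).congr ?_, eigenvec_ae hc hk⟩
  filter_upwards [fn_zero] with x hx
  rw [hx, potential₂_eq hc hk, sub_zero]

theorem exists_solves₂ (hc : 0 < c) (hk : 0 < k) {u : EvenL2}
    (hu : inner ℝ (eigenvec hc hk) u = 0) : ∃ s, Solves (potential₂ c k) u s := by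
  rw [inner_eq, innerL2_congr (eigenvec_ae hc hk) .rfl] at hu
  obtain ⟨w, w₁, hw, he⟩ := exists_factored_solution (half_sqrt_pos hc) (expo_pos hk) u.memLp_fn
    u.fn_even hu
  refine ⟨EvenL2.mk w hw.memLp (Eventually.of_forall he), w, w₁, ?_, fn_mk _ _⟩
  simpa only [potential₂_eq hc hk] using hw

/-- The Lyapunov–Schmidt data `D` realises the coupled system: `S` inverts `L₁`, and `D.R` inverts
`L₂` plus the orthogonal projection on the eigenfunction. -/
structure Realizes (c k : ℝ) (D : BifurcationData EvenL2) (S : EvenL2 →L[ℝ] EvenL2) (M : ℝ) :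
    Prop where
  M_pos : 0 < M
  k_eq : D.k = k
  g_ae : D.g.fn =ᵐ[volume] eigenfun c k
  ℓ_eq : ∀ u, D.ℓ u = inner ℝ D.g u
  S_iff : ∀ u s, Solves (potential₁ c) u s ↔ s = S u
  R_iff : ∀ u s, Solves (potential₂ c k) (u - (D.ℓ s / D.ℓ D.g) • D.g) s ↔ s = D.R u
  R_g : D.R D.g = D.g
  S_bdd : ∀ u, (∀ᵐ x, |(S u).fn x| ≤ M * ‖u‖) ∧ normH2 (S u).fn ≤ M * ‖u‖
  R_bdd : ∀ u, normH2 (D.R u).fn ≤ M * ‖u‖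
  b₁₁_ae : ∀ u v, (D.b₁₁ u v).fn =ᵐ[volume] fun x => (S u).fn x * (S v).fn x
  b₁₂_ae : ∀ u v, (D.b₁₂ u v).fn =ᵐ[volume] fun x => (S u).fn x * (D.R v).fn x
  b₂₂_ae : ∀ u v, (D.b₂₂ u v).fn =ᵐ[volume] fun x => (D.R u).fn x * (D.R v).fn x

/-- The abstract data are attained: `R` is the inverse of `L₂ + P`, which exists because `L₂` is
symmetric, annihilates `g` and maps onto the orthogonal complement of `g`. -/
theorem exists_realizes (hc : 0 < c) (hk : 0 < k) : ∃ D S M, Realizes c k D S M := by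
  set g := eigenvec hc hk with hg
  have hgpos : 0 < inner ℝ g g := by
    rw [real_inner_self_eq_norm_sq]
    have := norm_pos_iff.2 (eigenvec_ne_zero hc hk)
    positivity
  let ℓ : EvenL2 →L[ℝ] ℝ := innerSL ℝ g
  have hℓ : ∀ u, ℓ u = inner ℝ g u := fun u => rfl
  let P : EvenL2 →L[ℝ] EvenL2 := (ℓ g)⁻¹ • ℓ.smulRight g
  have hPu : ∀ u, P u = (ℓ u / ℓ g) • g := fun u => by
    simp [P, smul_smul, div_eq_inv_mul]
  have hP : ∀ u v, inner ℝ (P u) v = inner ℝ u (P v) := fun u v => by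
    rw [hPu, hPu, real_inner_smul_left, real_inner_smul_right, hℓ, hℓ, hℓ, real_inner_comm u g]
    ring
  obtain ⟨S, M₁, hM₁, hS, hSb⟩ := exists_inverse_operator (continuous_potential₁ c)
    (potential₁_bdd hc) 0 (fun u v => by simp) (fun u => by simpa using exists_solves₁ hc u)
  simp only [zero_apply, sub_zero] at hS
  have hg0 := solves_eigenvec hc hk
  rw [← hg] at hg0
  obtain ⟨R, M₂, hM₂, hR, hRb⟩ := exists_inverse_operator (continuous_potential₂ c k)
    (potential₂_bdd hc hk) P hP (fun u => by
      have h0 : inner ℝ g (u - P u) = 0 := by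
        rw [hPu, inner_sub_right, real_inner_smul_right, hℓ, hℓ, div_mul_cancel₀ _ hgpos.ne',
          sub_self]
      obtain ⟨s, hs⟩ := exists_solves₂ hc hk h0
      -- correct the component along `g`, which is in the kernel
      refine ⟨s + ((ℓ u - ℓ s) / ℓ g) • g, ?_⟩
      have h1 := hs.add (hg0.smul ((ℓ u - ℓ s) / ℓ g))
      have h2 : P (s + ((ℓ u - ℓ s) / ℓ g) • g) = P u := by
        rw [hPu, hPu, map_add, map_smul, smul_eq_mul, div_mul_cancel₀ _ (by rw [hℓ]; exact hgpos.ne')]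
        congr 2
        ring
      rwa [smul_zero, add_zero, ← h2] at h1)
  obtain ⟨B₁, hB₁⟩ := exists_product S (fun u => (hSb u).1)
  obtain ⟨B₂, hB₂⟩ := exists_product R (fun u => (hRb u).1)
  have hℓR : ∀ η, ℓ (R η) = ℓ η := fun η => by
    have h1 := hg0.symm (continuous_potential₂ c k) (potential₂_bdd hc hk) ((hR η _).2 rfl)
    rw [inner_zero_left, inner_sub_right, hPu, real_inner_smul_right, hℓ, hℓ,
      div_mul_cancel₀ _ hgpos.ne'] at h1
    rw [hℓ, hℓ]
    linarith
  let D : BifurcationData EvenL2 :=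
    { g := g
      ℓ := ℓ
      R := R
      b₁₁ := B₁.bilinearComp (.id ℝ _) S
      b₁₂ := B₁.bilinearComp (.id ℝ _) R
      b₂₂ := B₂.bilinearComp (.id ℝ _) R
      k := k
      k_pos := hk
      ℓ_g_pos := hgpos
      ℓ_R := hℓR }
  refine ⟨D, S, max M₁ M₂, lt_max_of_lt_left hM₁, rfl, eigenvec_ae hc hk, hℓ, hS, ?_, ?_, ?_, ?_,
    fun u v => hB₁ u (S v), fun u v => hB₁ u (R v), fun u v => hB₂ u (R v)⟩
  · intro u s
    rw [← hR, hPu]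
  · refine ((hR g g).1 ?_).symm
    rwa [hPu, div_self (by rw [hℓ]; exact hgpos.ne'), one_smul, sub_self]
  · intro u
    have hle : M₁ * ‖u‖ ≤ max M₁ M₂ * ‖u‖ := by gcongr; exact le_max_left _ _
    exact ⟨(hSb u).1.mono fun x hx => hx.trans hle, (hSb u).2.trans hle⟩
  · intro u
    have hle : M₂ * ‖u‖ ≤ max M₁ M₂ * ‖u‖ := by gcongr; exact le_max_right _ _
    exact (hRb u).2.trans hle

end Operators

/-! ### Profiles and the reduced system -/

section Assembly

open EvenL2

variable {c k : ℝ}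

theorem MemH2Even.add {U W : ℝ → ℝ} (hU : MemH2Even U) (hW : MemH2Even W) :
    MemH2Even (fun x => U x + W x) ∧
      ∀ᵐ x, weakDeriv₂ (fun x => U x + W x) x = weakDeriv₂ U x + weakDeriv₂ W x := by
  obtain ⟨u, u₁, u₂, hu, heu⟩ := hU.1.exists_isH2
  obtain ⟨w, w₁, w₂, hw, hew⟩ := hW.1.exists_isH2
  have he : (fun x => U x + W x) =ᵐ[volume] fun x => u x + w x := heu.add hew
  refine ⟨⟨(hu.add hw).memH2 he, ?_⟩, ?_⟩
  · filter_upwards [hU.2, hW.2] with x h1 h2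
    rw [h1, h2]
  · filter_upwards [(hu.add hw).weakDeriv₂_ae_eq he, hu.weakDeriv₂_ae_eq heu,
      hw.weakDeriv₂_ae_eq hew] with x h1 h2 h3
    rw [h1, h2, h3]

theorem MemH2Even.const_mul {U : ℝ → ℝ} (hU : MemH2Even U) (a : ℝ) :
    MemH2Even (fun x => a * U x) ∧ ∀ᵐ x, weakDeriv₂ (fun x => a * U x) x = a * weakDeriv₂ U x := by
  obtain ⟨u, u₁, u₂, hu, heu⟩ := hU.1.exists_isH2
  have he : (fun x => a * U x) =ᵐ[volume] fun x => a * u x := by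
    filter_upwards [heu] with x hx
    rw [hx]
  refine ⟨⟨(hu.const_mul a).memH2 he, ?_⟩, ?_⟩
  · filter_upwards [hU.2] with x h1
    rw [h1]
  · filter_upwards [(hu.const_mul a).weakDeriv₂_ae_eq he, hu.weakDeriv₂_ae_eq heu] with x h1 h2
    rw [h1, h2]

theorem MemH2.memLp {U : ℝ → ℝ} (hU : MemH2 U) : MemLp U 2 := by
  obtain ⟨_, _, _, _, h, _, _⟩ := hU
  exact h

theorem MemH2.ae_bdd {U : ℝ → ℝ} (hU : MemH2 U) : ∃ C, ∀ᵐ x, |U x| ≤ C := by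
  obtain ⟨u, u₁, u₂, hu, he⟩ := hU.exists_isH2
  refine ⟨√(2 * innerL2 u u + innerL2 u₁ u₁), ?_⟩
  filter_upwards [he] with x hx
  rw [hx]
  exact Real.abs_le_sqrt (hu.sq_le x)

theorem MemH2.memLp_mul {U W : ℝ → ℝ} (hU : MemH2 U) (hW : MemH2 W) :
    MemLp (fun x => U x * W x) 2 := by
  obtain ⟨C, hC⟩ := hU.ae_bdd
  refine hW.memLp.of_le_mul (c := C) (hU.memLp.1.mul hW.memLp.1) ?_
  filter_upwards [hC] with x hx
  rw [norm_mul]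
  gcongr
  exact hx

theorem normH2_congr {U W : ℝ → ℝ} (hU : MemH2 U) (h : W =ᵐ[volume] U) :
    normH2 W = normH2 U := by
  obtain ⟨u, u₁, u₂, hu, he⟩ := hU.exists_isH2
  rw [hu.normH2_eq he, hu.normH2_eq (h.trans he)]

theorem weakDeriv₂_soliton (hc : 0 < c) :
    ∀ᵐ x, weakDeriv₂ (soliton c) x = c * soliton c x - 1 / 2 * soliton c x ^ 2 := by
  obtain ⟨U₁, h⟩ := exists_isH2_soliton hc
  exact h.weakDeriv₂_ae_eq .rfl

namespace Realizes

variable {D : BifurcationData EvenL2} {S : EvenL2 →L[ℝ] EvenL2} {M : ℝ}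

theorem innerL2_eigenfun (h : Realizes c k D S M) {A : ℝ → ℝ} {u : EvenL2}
    (hA : u.fn =ᵐ[volume] A) : innerL2 (eigenfun c k) A = D.ℓ u := by
  rw [h.ℓ_eq, inner_eq, innerL2_congr h.g_ae hA]

theorem normL2_eigenfun (h : Realizes c k D S M) : normL2 (eigenfun c k) = ‖D.g‖ := by
  rw [← normL2_fn, normL2_congr h.g_ae]

theorem ℓ_g (h : Realizes c k D S M) : D.ℓ D.g = ‖D.g‖ ^ 2 := by
  rw [h.ℓ_eq, real_inner_self_eq_norm_sq]

theorem amplitude_eq (h : Realizes c k D S M) {A : ℝ → ℝ} {u : EvenL2}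
    (hA : u.fn =ᵐ[volume] A) : amplitude c k A = D.ℓ u / D.ℓ D.g := by
  rw [amplitude, h.innerL2_eigenfun hA, h.normL2_eigenfun, h.ℓ_g]

theorem q_eq (h : Realizes c k D S M) : D.q = bifCoeff c k := by
  -- `g²` as an element of the even `L²` space
  set f := D.b₂₂ D.g D.g with hf
  have hfe : f.fn =ᵐ[volume] fun x => eigenfun c k x ^ 2 := by
    filter_upwards [h.b₂₂_ae D.g D.g, h.g_ae] with x h1 h2
    rw [h1, h.R_g, h2, sq]
  have hex : ∃ W, MemH2Even W ∧ opL₁ c W =ᵐ[volume] fun x => eigenfun c k x ^ 2 := by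
    have hs := (h.S_iff f (S f)).2 rfl
    refine ⟨(S f).fn, hs.memH2Even, ?_⟩
    filter_upwards [hs.weakDeriv₂_ae_eq, hfe] with x h1 h2
    rw [opL₁, h1, ← h2, potential₁]
    ring
  have hinv : (S f).fn =ᵐ[volume] invL₁ c (fun x => eigenfun c k x ^ 2) := by
    rw [invL₁, dif_pos hex]
    obtain ⟨hW, hWe⟩ := hex.choose_spec
    have hfn := fn_mk hW.1.memLp hW.2
    have hs : Solves (potential₁ c) f (EvenL2.mk _ hW.1.memLp hW.2) := by
      refine .of_memH2Even hW hfn ?_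
      filter_upwards [hWe, hfe] with x h1 h2
      rw [h2, ← h1, opL₁, potential₁]
    rw [← (h.S_iff _ _).1 hs]
    exact hfn
  rw [bifCoeff, BifurcationData.q, h.ℓ_eq, inner_eq]
  refine integral_congr_ae ?_
  filter_upwards [h.g_ae, h.b₁₂_ae f D.g, hinv] with x h1 h2 h3
  rw [h2, h.R_g, h3, h1]
  ring

/-- A solution of the reduced system gives a profile of the coupled system. -/
theorem isProfile (h : Realizes c k D S M) (hc : 0 < c) {Ω : ℝ} {F θ : EvenL2}
    (hsol : D.IsSol (Ω - Omegac c k) F θ) :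
    MemH2Even (fun x => soliton c x + (S F).fn x) ∧ MemH2Even (D.R θ).fn ∧
      IsProfile c k 1 Ω (fun x => soliton c x + (S F).fn x) (D.R θ).fn := by
  have hs := (h.S_iff F (S F)).2 rfl
  have hr := (h.R_iff θ (D.R θ)).2 rfl
  obtain ⟨hm, hd⟩ := (memH2Even_soliton hc).add hs.memH2Even
  refine ⟨hm, hr.memH2Even, ?_, ?_⟩
  · have h0 := fn_add ((1 / 2 : ℝ) • D.b₁₁ F F) (D.b₂₂ θ θ)
    rw [← hsol.1] at h0
    filter_upwards [hd, hs.weakDeriv₂_ae_eq, weakDeriv₂_soliton hc, h0,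
      fn_smul (1 / 2) (D.b₁₁ F F), h.b₁₁_ae F F, h.b₂₂_ae θ θ] with x h1 h2 h3 h4 h5 h6 h7
    rw [h1, h2, h3, h4, h5, h6, h7, potential₁]
    ring
  · have h0 : θ - (D.ℓ (D.R θ) / D.ℓ D.g) • D.g =
        (Ω - Omegac c k) • D.R θ + k • D.b₁₂ F θ := by
      rw [D.ℓ_R, sub_eq_iff_eq_add]
      conv_lhs => rw [hsol.2, h.k_eq]
      abel
    have h0' := fn_add ((Ω - Omegac c k) • D.R θ) (k • D.b₁₂ F θ)
    rw [← h0] at h0'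
    filter_upwards [hr.weakDeriv₂_ae_eq, h0', fn_smul (Ω - Omegac c k) (D.R θ),
      fn_smul k (D.b₁₂ F θ), h.b₁₂_ae F θ] with x h1 h2 h3 h4 h5
    rw [h1, h2, h3, h4, h5, potential₂]
    ring

/-- A profile of the coupled system comes from a solution of the reduced system. -/
theorem exists_isSol (h : Realizes c k D S M) (hc : 0 < c) {Ω : ℝ} {V B : ℝ → ℝ}
    (hV : MemH2Even V) (hB : MemH2Even B) (hVB : IsProfile c k 1 Ω V B) :
    ∃ F θ, D.IsSol (Ω - Omegac c k) F θ ∧ V =ᵐ[volume] (fun x => soliton c x + (S F).fn x) ∧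
      B =ᵐ[volume] (D.R θ).fn ∧ ‖F‖ ≤ (2 * (3 * c) + 2) * normH2 (V - soliton c) := by
  obtain ⟨hm, hmd⟩ := (memH2Even_soliton hc).const_mul (-1)
  obtain ⟨hw, hwd⟩ := hV.add hm
  set w : ℝ → ℝ := fun x => V x + -1 * soliton c x with hwdef
  have hww : MemLp (fun x => 1 / 2 * (w x * w x)) 2 := (hw.1.memLp_mul hw.1).const_mul _
  have hBB := hB.1.memLp_mul hB.1
  have hwB := hw.1.memLp_mul hB.1
  let W := EvenL2.mk w hw.1.memLp hw.2
  have hW : W.fn =ᵐ[volume] w := fn_mk _ _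
  let β := EvenL2.mk B hB.1.memLp hB.2
  have hβ : β.fn =ᵐ[volume] B := fn_mk _ _
  let F := EvenL2.mk (fun x => 1 / 2 * (w x * w x) + B x * B x) (hww.add hBB) (by
    filter_upwards [hw.2, hB.2] with x h1 h2
    rw [h1, h2])
  have hF : F.fn =ᵐ[volume] fun x => 1 / 2 * (w x * w x) + B x * B x := fn_mk _ _
  let N := EvenL2.mk (fun x => (Ω - Omegac c k) * B x + k * (w x * B x))
    ((hB.1.memLp.const_mul _).add (hwB.const_mul _)) (by
    filter_upwards [hw.2, hB.2] with x h1 h2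
    rw [h1, h2])
  have hN : N.fn =ᵐ[volume] fun x => (Ω - Omegac c k) * B x + k * (w x * B x) := fn_mk _ _
  let θ : EvenL2 := N + (D.ℓ β / D.ℓ D.g) • D.g
  have hSF : Solves (potential₁ c) F W := by
    refine .of_memH2Even hw hW ?_
    filter_upwards [hwd, hmd, weakDeriv₂_soliton hc, hVB.1, hF] with x h1 h2 h3 h4 h5
    rw [h1, h2, h3, h5, potential₁]
    simp only [hwdef]
    linear_combination -h4
  have hWS : W = S F := (h.S_iff F W).1 hSF
  have hRθ : β = D.R θ := by
    refine (h.R_iff θ β).1 (.of_memH2Even hB hβ ?_)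
    have h0 : θ - (D.ℓ β / D.ℓ D.g) • D.g = N := add_sub_cancel_right _ _
    rw [h0]
    filter_upwards [hVB.2, hN] with x h1 h2
    rw [h2, potential₂]
    simp only [hwdef]
    linear_combination -h1
  have hℓ : D.ℓ β = D.ℓ θ := by rw [hRθ, D.ℓ_R]
  refine ⟨F, θ, ⟨?_, ?_⟩, ?_, ?_, ?_⟩
  · refine ext_ae ?_
    filter_upwards [hF, fn_add ((1 / 2 : ℝ) • D.b₁₁ F F) (D.b₂₂ θ θ), fn_smul (1 / 2) (D.b₁₁ F F),
      h.b₁₁_ae F F, h.b₂₂_ae θ θ, hW, hβ] with x h1 h2 h3 h4 h5 h6 h7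
    rw [h1, h2, h3, h4, h5, ← hWS, ← hRθ, h6, h7]
  · have h0 : N = (Ω - Omegac c k) • D.R θ + D.k • D.b₁₂ F θ := by
      refine ext_ae ?_
      rw [h.k_eq]
      filter_upwards [hN, fn_add ((Ω - Omegac c k) • D.R θ) (k • D.b₁₂ F θ),
        fn_smul (Ω - Omegac c k) (D.R θ), fn_smul k (D.b₁₂ F θ), h.b₁₂_ae F θ, hW, hβ]
        with x h1 h2 h3 h4 h5 h6 h7
      rw [h1, h2, h3, h4, h5, ← hWS, ← hRθ, h6, h7]
    rw [add_assoc, ← h0, ← hℓ, add_comm]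
  · rw [← hWS]
    filter_upwards [hW] with x hx
    rw [hx, hwdef]
    ring
  · rw [← hRθ]
    exact hβ.symm
  · have h1 := hSF.norm_le_normH2 (potential₁_bdd hc)
    have h2 : normH2 (V - soliton c) = normH2 W.fn := by
      rw [normH2_congr hw.1 hW, show V - soliton c = w from funext fun x => by
        simp only [Pi.sub_apply, hwdef]; ring]
    rwa [h2]

end Realizes

end Assembly

end KdVLS

theorem mainTheorem2 (c k : ℝ) (hc : 0 < c) (hk : 0 < k)
    (hq : KdVLS.bifCoeff c k ≠ 0) :
    ∃ (C ε r : ℝ) (U A : ℝ → ℝ → ℝ), 0 < C ∧ 0 < ε ∧ 0 < r ∧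
      ∀ Ω : ℝ, |Ω - KdVLS.Omegac c k| < ε →
        SignType.sign (Ω - KdVLS.Omegac c k) = -SignType.sign (KdVLS.bifCoeff c k) →
        -- the member of the family at `Ω`, normalised by `a > 0`
        (KdVLS.MemH2Even (U Ω) ∧ KdVLS.MemH2Even (A Ω) ∧
          KdVLS.IsProfile c k 1 Ω (U Ω) (A Ω) ∧
          0 < KdVLS.amplitude c k (A Ω) ∧
          KdVLS.normH2 (U Ω - KdVLS.soliton c) ≤ C * |Ω - KdVLS.Omegac c k| ∧
          KdVLS.normH2 (A Ω) ≤ C * Real.sqrt |Ω - KdVLS.Omegac c k| ∧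
          |(Ω - KdVLS.Omegac c k) -
              (-k * KdVLS.amplitude c k (A Ω) ^ 2 *
                (KdVLS.bifCoeff c k / KdVLS.normL2 (KdVLS.eigenfun c k) ^ 2))|
            ≤ C * KdVLS.amplitude c k (A Ω) ^ 4) ∧
        -- uniqueness, up to the symmetry `A ↦ -A`, among coupled profiles near the soliton
        (∀ V B : ℝ → ℝ, KdVLS.MemH2Even V → KdVLS.MemH2Even B →
          KdVLS.IsProfile c k 1 Ω V B → ¬ B =ᵐ[volume] 0 →
          KdVLS.normH2 (V - KdVLS.soliton c) < r → KdVLS.normL2 B < r →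
          V =ᵐ[volume] U Ω ∧ (B =ᵐ[volume] A Ω ∨ B =ᵐ[volume] -A Ω)) := by
  obtain ⟨D, S, M, h⟩ := KdVLS.exists_realizes hc hk
  have hM := h.M_pos
  have hG := D.ℓ_g_pos
  rw [← h.q_eq] at hq ⊢
  obtain ⟨C, ε, r, F, θ, hC, hε, hr, hall⟩ := D.exists_branch hq
  have hgn : 0 < ‖D.g‖ := by
    rw [norm_pos_iff]
    rintro h0
    simp [h0] at hG
  refine ⟨max C (M * C), ε, min (r / (2 * (3 * c) + 2)) (r * ‖D.g‖),
    fun Ω x => KdVLS.soliton c x + (S (F (Ω - KdVLS.Omegac c k))).fn x,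
    fun Ω => (D.R (θ (Ω - KdVLS.Omegac c k))).fn, by positivity, hε, by positivity, ?_⟩
  intro Ω hΩ hsign
  set δ := Ω - KdVLS.Omegac c k with hδ
  obtain ⟨⟨hsol, hpos, hFn, hθn, hamp⟩, huniq⟩ := hall δ hΩ hsign
  obtain ⟨hU, hA, hprof⟩ := h.isProfile hc hsol
  have ha : KdVLS.amplitude c k (D.R (θ δ)).fn = D.ℓ (θ δ) / D.ℓ D.g := by
    rw [h.amplitude_eq .rfl, D.ℓ_R]
  have hsub : (fun x => KdVLS.soliton c x + (S (F δ)).fn x) - KdVLS.soliton c = (S (F δ)).fn :=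
    funext fun x => by simp
  have hMC : ∀ t, 0 ≤ t → M * (C * t) ≤ max C (M * C) * t := fun t ht => by
    rw [← mul_assoc]
    gcongr
    exact le_max_right _ _
  refine ⟨⟨hU, hA, hprof, ?_, ?_, ?_, ?_⟩, ?_⟩
  · rw [ha]
    positivity
  · rw [hsub]
    exact ((h.S_bdd _).2.trans (by gcongr)).trans (hMC _ (abs_nonneg δ))
  · exact ((h.R_bdd _).trans (by gcongr)).trans (hMC _ (Real.sqrt_nonneg _))
  · rw [ha, h.normL2_eigenfun, ← h.ℓ_g]
    rw [h.k_eq] at hamp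
    refine hamp.trans ?_
    gcongr
    exact le_max_left _ _
  · intro V B hV hB hVB hB0 hVr hBr
    obtain ⟨F', θ', hsol', hVe, hBe, hF'⟩ := h.exists_isSol hc hV hB hVB
    have hθ' : θ' ≠ 0 := by
      rintro rfl
      rw [map_zero] at hBe
      exact hB0 (hBe.trans KdVLS.EvenL2.fn_zero)
    have hF'r : ‖F'‖ < r := by
      refine hF'.trans_lt ?_
      have h1 := hVr.trans_le (min_le_left _ _)
      rw [lt_div_iff₀ (by positivity)] at h1
      linarith
    have ha' : |D.ℓ θ' / D.ℓ D.g| < r := by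
      have h1 : |D.ℓ θ'| ≤ ‖D.g‖ * KdVLS.normL2 B := by
        rw [← D.ℓ_R, h.ℓ_eq, KdVLS.normL2_congr hBe, KdVLS.EvenL2.normL2_fn]
        exact abs_real_inner_le_norm _ _
      have h2 := hBr.trans_le (min_le_right _ _)
      rw [abs_div, abs_of_pos hG, div_lt_iff₀ hG, h.ℓ_g]
      calc |D.ℓ θ'| ≤ ‖D.g‖ * KdVLS.normL2 B := h1
        _ < ‖D.g‖ * (r * ‖D.g‖) := by gcongr
        _ = r * ‖D.g‖ ^ 2 := by ring
    obtain ⟨hFF, hθθ⟩ := huniq F' θ' hsol' hθ' hF'r ha'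
    subst hFF
    refine ⟨hVe, ?_⟩
    rcases hθθ with h1 | h1
    · exact Or.inl (by rw [h1] at hBe; exact hBe)
    · refine Or.inr (hBe.trans ?_)
      rw [h1, map_neg]
      exact KdVLS.EvenL2.fn_neg _
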